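/- Throughout, a closed curve is a continuous $\gamma:[0,1]\to\mathbb{R}^2$ with $\gamma(0)=\gamma(1)$, extended $1$-periodically to $\mathbb{R}$. Let $\Gamma$ be the class of simple closed curves that have, at every parameter, left and right unit tangent vectors in the direction of the curve, these two being equal for almost every parameter. The normal of a tangent vector is given by the right-hand rule (clockwise quarter turn). For $p\in\gamma$ let $N(p)$ be the set of all unit vectors between the normals of the left and of the right tangent at $p$. For $q\in\mathbb{R}^2$ let $p=\operatorname{argmin}_{p'\in\gamma}\|q-p'\|$ and $n_p(q)=\operatorname{argmax}\{|\langle u,q-p\rangle| : u\in N(p)\}$, where any maximizer or minimizer may be taken, and for $\sigma>0$ put $$v_q^\sigma(\gamma)=\tfrac1\sigma\langle n_p(q),q-p\rangle\,e^{-\|q-p\|^2/\sigma^2},\qquad \bar v_q^{\sigma}(\gamma)=\tfrac1\sigma\langle n_p(q),q-p\rangle ;$$ thus $\bar v_q^\sigma$ is the feature $v_q^\sigma$ for which the exponential factor, which tends to $1$ as $\sigma\to\infty$, is ignored. Let $\Omega\subset\mathbb{R}^2$ be a bounded domain (nonempty, open, connected), and let the landmarks $Q$ be given by the uniform probability density $\mu=1_\Omega/|\Omega|$.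 Put $$d_Q^{\sigma,\infty}(\gamma,\gamma')=\sup_{q:\ \mu(q)>0}|v^\sigma_q(\gamma)-v^\sigma_q(\gamma')|,\qquad \bar d_Q^{\,\sigma,\infty}(\gamma,\gamma')=\sup_{q:\ \mu(q)>0}|\bar v^\sigma_q(\gamma)-\bar v^\sigma_q(\gamma')|.$$ Let $d_H$ be the Hausdorff distance of the images, and let $$d_F(\gamma,\gamma')=\inf_{\alpha}\max\Big\{\sup_t\|\gamma(t)-\gamma'(\alpha(t))\|,\ \sup_t\|\gamma(\alpha^{-1}(t))-\gamma'(t)\|\Big\}$$ be the Fréchet distance of oriented closed curves, where $\alpha$ runs over the nondecreasing, not necessarily continuous functions $\alpha:\mathbb{R}\to\mathbb{R}$ with $\alpha(t+1)=\alpha(t)+1$ (the monotone cyclic parametrizations) and $\alpha^{-1}(y)=\inf\{x:y\le\alpha(x)\}$. Call $(\gamma,\gamma')$ admissible for $\sigma>0$ if $\gamma,\gamma'\in\Gamma$ have images in $\Omega$, both curves are convex (each is the boundary of its convex hull), both are oriented counterclockwise or both clockwise (winding number $+1$, respectively $-1$, about an interior point of the convex hull), and $d_H(\gamma,\gamma')\le\sigma/\sqrt{2e}$.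 **Corollary (equality for closed convex curves, for $\sigma$ sufficiently large).** 1. For every $\sigma>0$ and every pair $(\gamma,\gamma')$ admissible for $\sigma$, one has equality when the exponential factor is ignored, $$\bar d_Q^{\,\sigma,\infty}(\gamma,\gamma')=\tfrac1\sigma d_F(\gamma,\gamma'),$$ and with the exponential factor $$e^{-d_H(\gamma,\gamma')^2/\sigma^2}\,\tfrac1\sigma d_F(\gamma,\gamma')\ \le\ d_Q^{\sigma,\infty}(\gamma,\gamma')\ \le\ \tfrac1\sigma d_F(\gamma,\gamma').$$ 2. The equality $d_Q^{\sigma,\infty}=\frac1\sigma d_F$ holds for large $\sigma$ up to a relative error that tends to $0$ uniformly over all admissible pairs: for every $\varepsilon>0$ there is $\sigma_0>0$, depending only on $\Omega$ and $\varepsilon$, such that for all $\sigma\ge\sigma_0$ and all pairs $(\gamma,\gamma')$ admissible for $\sigma$, $$\Big|d_Q^{\sigma,\infty}(\gamma,\gamma')-\tfrac1\sigma d_F(\gamma,\gamma')\Big|\ \le\ \varepsilon\cdot\tfrac1\sigma d_F(\gamma,\gamma').$$ -/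

import Mathlib

open Real Set Filter Topology MeasureTheory
open scoped RealInnerProductSpace

noncomputable section

/-- The Euclidean plane. -/
abbrev Plane : Type := EuclideanSpace ℝ (Fin 2)

/-! ### Closed curves, tangents and normals

A closed curve `γ : [0,1] → ℝ²`, `γ 0 = γ 1`, is represented by its `1`-periodic extension to `ℝ`,
so that the common endpoint is treated like every other point. -/

/-- `T` is the unit tangent vector of `γ` on the right of the parameter `t`,
pointing in the direction of increasing parameters. -/
def HasRightTangent (γ : ℝ → Plane) (t : ℝ) (T : Plane) : Prop :=
  Tendsto (fun s => ‖γ s - γ t‖⁻¹ • (γ s - γ t)) (𝓝[>] t) (𝓝 T)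

/-- `T` is the unit tangent vector of `γ` on the left of the parameter `t`,
pointing in the direction of increasing parameters. -/
def HasLeftTangent (γ : ℝ → Plane) (t : ℝ) (T : Plane) : Prop :=
  Tendsto (fun s => ‖γ t - γ s‖⁻¹ • (γ t - γ s)) (𝓝[<] t) (𝓝 T)

/-- `γ t` is a regular point: the curve has one (oriented) tangent there. -/
def IsRegularParam (γ : ℝ → Plane) (t : ℝ) : Prop :=
  ∃ T, HasLeftTangent γ t T ∧ HasRightTangent γ t T

/-- The closed members of the class `Γ`: simple closed curves for which almost every parameter
is regular and which have one-sided tangents everywhere. -/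
structure IsClosedCurve (γ : ℝ → Plane) : Prop where
  continuous : Continuous γ
  periodic : Function.Periodic γ 1
  simple : InjOn γ (Ico 0 1)
  regular_ae : ∀ᵐ t : ℝ, IsRegularParam γ t
  left_tangent : ∀ t, ∃ T, HasLeftTangent γ t T
  right_tangent : ∀ t, ∃ T, HasRightTangent γ t T

/-- The curve is convex: it is the boundary of its convex hull. -/
def IsConvexCurve (γ : ℝ → Plane) : Prop :=
  range γ = frontier (convexHull ℝ (range γ))

/-- The closed curve `γ` avoids the point `c` and winds `k` times counterclockwise around it:
`θ` is a continuous choice of the polar angle of `γ` about `c`. -/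
def HasWindingNumber (γ : ℝ → Plane) (c : Plane) (k : ℤ) : Prop :=
  c ∉ range γ ∧ ∃ θ : ℝ → ℝ, Continuous θ ∧
    (∀ t, γ t = c + ‖γ t - c‖ • !₂[Real.cos (θ t), Real.sin (θ t)]) ∧
    ∀ t, θ (t + 1) = θ t + 2 * π * k

/-- A closed convex curve is oriented counterclockwise. -/
def IsCounterclockwise (γ : ℝ → Plane) : Prop :=
  ∃ c ∈ interior (convexHull ℝ (range γ)), HasWindingNumber γ c 1

/-- A closed convex curve is oriented clockwise. -/
def IsClockwise (γ : ℝ → Plane) : Prop :=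
  ∃ c ∈ interior (convexHull ℝ (range γ)), HasWindingNumber γ c (-1)

/-- Both curves are counterclockwise or both are clockwise. -/
def SameOrientation (γ γ' : ℝ → Plane) : Prop :=
  (IsCounterclockwise γ ∧ IsCounterclockwise γ') ∨ (IsClockwise γ ∧ IsClockwise γ')

/-- The normal vector belonging to a tangent vector, by the right-hand rule
(rotation by a quarter turn clockwise). -/
def rightNormal (T : Plane) : Plane := !₂[T 1, -T 0]

/-- `N(p)` at `p = γ t`: all unit vectors between the normal vectors of the left and of the right
tangent. At a regular point this is the one unit normal vector. -/
def normalSet (γ : ℝ → Plane) (t : ℝ) : Set Plane :=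
  {u | ‖u‖ = 1 ∧ ∃ T₁ T₂, HasLeftTangent γ t T₁ ∧ HasRightTangent γ t T₂ ∧
    ∃ a b : ℝ, 0 ≤ a ∧ 0 ≤ b ∧ u = a • rightNormal T₁ + b • rightNormal T₂}

/-! ### The feature mapping -/

/-- A parameter of a point `p = argmin_{p' ∈ γ} ‖q - p'‖`. -/
def argminParam (γ : ℝ → Plane) (q : Plane) : ℝ :=
  Classical.epsilon fun t => ∀ s, ‖q - γ t‖ ≤ ‖q - γ s‖

/-- The point `p = argmin_{p' ∈ γ} ‖q - p'‖`. -/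
def nearestPoint (γ : ℝ → Plane) (q : Plane) : Plane := γ (argminParam γ q)

/-- `n_p(q) = argmax {|⟨u, q - p⟩| : u ∈ N(p)}` for `p = nearestPoint γ q`. -/
def nearestNormal (γ : ℝ → Plane) (q : Plane) : Plane :=
  Classical.epsilon fun u => u ∈ normalSet γ (argminParam γ q) ∧
    ∀ w ∈ normalSet γ (argminParam γ q),
      |⟪w, q - nearestPoint γ q⟫| ≤ |⟪u, q - nearestPoint γ q⟫|

/-- The feature `v_q^σ(γ) = (1/σ) ⟨n_p(q), q - p⟩ exp(-‖q - p‖² / σ²)` of a closed curve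
(there are no endpoints). -/
def feature (σ : ℝ) (γ : ℝ → Plane) (q : Plane) : ℝ :=
  1 / σ * ⟪nearestNormal γ q, q - nearestPoint γ q⟫ *
    Real.exp (-(‖q - nearestPoint γ q‖ ^ 2 / σ ^ 2))

/-- The feature with its exponential factor, which tends to `1` as `σ → ∞`, replaced by `1`:
`(1/σ) ⟨n_p(q), q - p⟩`. -/
def largeScaleFeature (σ : ℝ) (γ : ℝ → Plane) (q : Plane) : ℝ :=
  1 / σ * ⟪nearestNormal γ q, q - nearestPoint γ q⟫

/-! ### Distances -/

/-- The `l^∞` distance of two feature functions over the landmarks `{x | μ x > 0}` of a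
density `μ`. -/
def landmarkSupDist (μ : Plane → ℝ) (v w : Plane → ℝ) : ℝ :=
  ⨆ q : {x : Plane // 0 < μ x}, |v q - w q|

/-- The density of the uniform probability measure on `Ω`. -/
def uniformDensity (Ω : Set Plane) : Plane → ℝ :=
  Ω.indicator fun _ => (volume.real Ω)⁻¹

/-- The orientation preserving distance `d_Q^{σ,∞}`, where the landmarks `Q` are
distributed with density `μ`. -/
def orientationDist (μ : Plane → ℝ) (σ : ℝ) (γ γ' : ℝ → Plane) : ℝ :=
  landmarkSupDist μ (feature σ γ) (feature σ γ')

/-- `d_Q^{σ,∞}` with the exponential factors of the features replaced by `1`. -/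
def largeScaleOrientationDist (μ : Plane → ℝ) (σ : ℝ) (γ γ' : ℝ → Plane) : ℝ :=
  landmarkSupDist μ (largeScaleFeature σ γ) (largeScaleFeature σ γ')

/-- The Hausdorff distance of (the images of) two curves. -/
def hausdorffDistance (γ γ' : ℝ → Plane) : ℝ :=
  Metric.hausdorffDist (range γ) (range γ')

/-- The inverse of a monotone cyclic parametrization `α`, given by its lift to `ℝ`. If `α` jumps at
`t` from `a` to `b`, the inverse has the constant value `t` on `(a, b)`. -/
def cyclicInverse (α : CircleDeg1Lift) (y : ℝ) : ℝ := sInf {x | y ≤ α x}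

/-- The Fréchet distance of oriented closed curves. The monotone cyclic parametrizations are
given by their lifts to `ℝ`: nondecreasing `α : ℝ → ℝ` with `α (t + 1) = α t + 1`,
not necessarily continuous. -/
def frechetDistance (γ γ' : ℝ → Plane) : ℝ :=
  ⨅ α : CircleDeg1Lift,
    max (⨆ t : ℝ, ‖γ t - γ' (α t)‖) (⨆ t : ℝ, ‖γ (cyclicInverse α t) - γ' t‖)

/-- A pair of closed convex curves of the class `Γ` with images in `Ω` and the same orientation. -/
structure IsConvexPair (Ω : Set Plane) (γ γ' : ℝ → Plane) : Prop where
  closed_left : IsClosedCurve γ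
  closed_right : IsClosedCurve γ'
  convex_left : IsConvexCurve γ
  convex_right : IsConvexCurve γ'
  subset_left : range γ ⊆ Ω
  subset_right : range γ' ⊆ Ω
  orientation : SameOrientation γ γ'

end

noncomputable section

open scoped ContDiff NNReal Convolution

/-! ### Convex bodies and the signed distance to their boundary -/

/-! Everything is reduced to the Hausdorff distance of the two curves, in two independent halves.

Features. Let `K` be the convex hull of `γ`, so that `γ` is its boundary, and let `s` be the signed
distance to that boundary. If `p` is a point of `γ` nearest to `q`, then `q - p = s(q) u` for an
outer normal `u` at `p`. Up to the orientation sign `e = ±1` this `u` belongs to `N(p)`, so a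
maximizing normal is `u` or `-u` when `s(q) ≠ 0`, and the position of an interior point decides
which. Hence the feature is `e s(q) / σ`, times `exp(-s(q)² / σ²)` if the exponential is kept
(`IsOrientedBoundary.inner_nearestNormal`). The signed distances of two convex bodies differ by at
most the Hausdorff distance of their boundaries (`IsConvexBody.abs_boundarySignedDist_sub_le`). On
one of the curves one signed distance is zero and the other is, up to sign, the distance to the
other curve; as both curves consist of landmarks, the bound is attained. With the exponential, the
upper bound survives because `x exp(-x²)` is 1-Lipschitz, and on the curves at most the factor
`exp(-d_H² / σ²)` is lost. This factor tends to `1` uniformly since `d_H ≤ diam Ω`.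

Fréchet distance. For convex curves of equal orientation it equals `d_H`
(`frechetDistance_eq_hausdorffDistance`); only `≤` needs work, and it suffices to prove it up to
`ε`. Both curves are approximated by curves with smooth support functions `h₀`, `h₁` and positive
radius of curvature (`IsPolarAngle.exists_isSmoothSupport`); then `|h₁ - h₀| ≤ d_H + ε/2`. The
support function is moved linearly from `h₀` to `h₁`, and the normal angle of each point is moved by
a flow that cancels the tangential velocity. Every point then travels with normal speed `|h₁ - h₀|`
for unit time, and the time one map of the flow is the required monotone reparametrization
(`IsSmoothSupport.exists_orderIso_dist_le`). Clockwise curves are treated by reversal. -/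

/-- The distance to the boundary of `K`, with a negative sign inside `K`. -/
def boundarySignedDist (K : Set Plane) (q : Plane) : ℝ :=
  open Classical in
  if q ∈ K then -Metric.infDist q (frontier K) else Metric.infDist q (frontier K)

theorem boundarySignedDist_of_mem {K : Set Plane} {q : Plane} (h : q ∈ K) :
    boundarySignedDist K q = -Metric.infDist q (frontier K) := by
  simp [boundarySignedDist, h]

theorem boundarySignedDist_of_notMem {K : Set Plane} {q : Plane} (h : q ∉ K) :
    boundarySignedDist K q = Metric.infDist q (frontier K) := by
  simp [boundarySignedDist, h]

theorem abs_boundarySignedDist (K : Set Plane) (q : Plane) :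
    |boundarySignedDist K q| = Metric.infDist q (frontier K) := by
  by_cases h : q ∈ K
  · rw [boundarySignedDist_of_mem h, abs_neg, abs_of_nonneg Metric.infDist_nonneg]
  · rw [boundarySignedDist_of_notMem h, abs_of_nonneg Metric.infDist_nonneg]

theorem boundarySignedDist_of_mem_frontier {K : Set Plane} {q : Plane} (h : q ∈ frontier K) :
    boundarySignedDist K q = 0 := by
  rw [← abs_eq_zero, abs_boundarySignedDist, Metric.infDist_zero_of_mem h]

/-- `u` is a unit outer normal vector of `K` at `p`. -/
def IsOuterNormal (K : Set Plane) (p u : Plane) : Prop :=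
  ‖u‖ = 1 ∧ ∀ x ∈ K, ⟪u, x - p⟫ ≤ 0

/-- Hahn–Banach separates `p` from the open interior, and the weak inequality passes to `K`, which
lies in the closure of its interior. Strictness at one interior point makes the functional nonzero.
-/
theorem exists_outerNormal {K : Set Plane} (hK : Convex ℝ K) (hi : (interior K).Nonempty)
    {p : Plane} (hp : p ∈ frontier K) : ∃ u, IsOuterNormal K p u := by
  obtain ⟨f, hf⟩ := geometric_hahn_banach_open_point hK.interior isOpen_interior hp.2
  have hle : ∀ x ∈ K, f x ≤ f p := by
    intro x hx
    have hx' : x ∈ closure (interior K) := by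
      rw [hK.closure_interior_eq_closure_of_nonempty_interior hi]
      exact subset_closure hx
    have : closure (interior K) ⊆ {y | f y ≤ f p} :=
      closure_minimal (fun y hy => (hf y hy).le) (isClosed_le f.continuous continuous_const)
    exact this hx'
  set w : Plane := (InnerProductSpace.toDual ℝ Plane).symm f with hw
  have hfw : ∀ x, f x = ⟪w, x⟫ := fun x => by
    rw [hw, InnerProductSpace.toDual_symm_apply]
  have hw0 : w ≠ 0 := by
    rintro h0
    obtain ⟨c, hc⟩ := hi
    have := hf c hc
    simp [hfw, h0] at this
  refine ⟨‖w‖⁻¹ • w, norm_smul_inv_norm hw0, fun x hx => ?_⟩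
  rw [inner_smul_left, inner_sub_right, ← hfw, ← hfw]
  exact mul_nonpos_of_nonneg_of_nonpos (by simp) (by linarith [hle x hx])

theorem IsOuterNormal.inner_neg_of_mem_interior {K : Set Plane} {p u c : Plane}
    (h : IsOuterNormal K p u) (hc : c ∈ interior K) : ⟪u, c - p⟫ < 0 := by
  obtain ⟨r, hr, hb⟩ := Metric.isOpen_iff.1 isOpen_interior c hc
  have hm : c + (r / 2) • u ∈ K := interior_subset <| hb <| by
    rw [mem_ball_iff_norm, add_sub_cancel_left, norm_smul, h.1, Real.norm_eq_abs,
      abs_of_pos (by positivity)]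
    linarith
  have := h.2 _ hm
  rw [add_sub_right_comm, inner_add_right, inner_smul_right, real_inner_self_eq_norm_sq, h.1] at this
  linarith

theorem exists_mem_frontier_forall_le {K : Set Plane} (hK : IsCompact K) (hne : K.Nonempty)
    {u : Plane} (hu : ‖u‖ = 1) : ∃ z ∈ frontier K, ∀ x ∈ K, ⟪u, x⟫ ≤ ⟪u, z⟫ := by
  obtain ⟨z, hz, hmax⟩ := hK.exists_isMaxOn hne
    (f := fun x => ⟪u, x⟫) (by fun_prop : Continuous fun x : Plane => ⟪u, x⟫).continuousOn
  refine ⟨z, ⟨subset_closure hz, fun hzi => ?_⟩, fun x hx => hmax hx⟩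
  have : IsOuterNormal K z u := ⟨hu, fun x hx => by
    rw [inner_sub_right]; exact sub_nonpos.2 (hmax hx)⟩
  simpa using this.inner_neg_of_mem_interior hzi

theorem exists_mem_frontier_segment {K : Set Plane} {q x : Plane} (hx : x ∈ K) (hq : q ∉ K) :
    ∃ y ∈ frontier K, y ∈ segment ℝ q x := by
  by_contra! h
  obtain ⟨y, -, hy, hy'⟩ := (convex_segment (𝕜 := ℝ) q x).isPreconnected (interior K)
    (closure K)ᶜ isOpen_interior isClosed_closure.isOpen_compl
    (fun y hy => by
      by_cases hyc : y ∈ closure K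
      · exact Or.inl (by_contra fun hyi => h y ⟨hyc, hyi⟩ hy)
      · exact Or.inr hyc)
    ⟨x, right_mem_segment ℝ q x,
      by_contra fun hxi => h x ⟨subset_closure hx, hxi⟩ (right_mem_segment ℝ q x)⟩
    ⟨q, left_mem_segment ℝ q x,
      fun hqc => h q ⟨hqc, fun hqi => hq (interior_subset hqi)⟩ (left_mem_segment ℝ q x)⟩
  exact hy' (subset_closure (interior_subset hy))

theorem ball_infDist_frontier_subset {K : Set Plane} {q : Plane} (hq : q ∈ K) :
    Metric.ball q (Metric.infDist q (frontier K)) ⊆ K := by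
  intro x hx
  by_contra hxK
  obtain ⟨y, hy, hs⟩ := exists_mem_frontier_segment hq hxK
  rw [segment_symm] at hs
  have h1 := Metric.infDist_le_dist_of_mem (x := q) hy
  have h2 := norm_sub_le_of_mem_segment hs
  rw [Metric.mem_ball, dist_comm] at hx
  rw [dist_eq_norm] at hx h1
  rw [norm_sub_rev, norm_sub_rev x] at h2
  linarith

theorem closedBall_infDist_frontier_subset {K : Set Plane} (hK : IsClosed K) {q : Plane}
    (hq : q ∈ K) : Metric.closedBall q (Metric.infDist q (frontier K)) ⊆ K := by
  rcases eq_or_ne (Metric.infDist q (frontier K)) 0 with h | h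
  · rw [h, Metric.closedBall_zero]
    simpa using hq
  · rw [← closure_ball q h]
    exact closure_minimal (ball_infDist_frontier_subset hq) hK

theorem infDist_eq_norm_of_nearest {G : Set Plane} {p q : Plane} (hp : p ∈ G)
    (hn : ∀ y ∈ G, ‖q - p‖ ≤ ‖q - y‖) : Metric.infDist q G = ‖q - p‖ := by
  refine le_antisymm ?_ ?_
  · rw [← dist_eq_norm]; exact Metric.infDist_le_dist_of_mem hp
  · exact (Metric.le_infDist ⟨p, hp⟩).2 fun {y} hy => by rw [dist_eq_norm]; exact hn y hy

/-- A point of the boundary of a convex body that is nearest to `q` has an outer normal vector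
in the direction of `q`. -/
theorem exists_outerNormal_of_nearest {K : Set Plane} (hK : Convex ℝ K) (hc : IsClosed K)
    (hi : (interior K).Nonempty) {p q : Plane} (hp : p ∈ frontier K)
    (hn : ∀ y ∈ frontier K, ‖q - p‖ ≤ ‖q - y‖) :
    ∃ u, IsOuterNormal K p u ∧ q - p = boundarySignedDist K q • u := by
  have hdist := infDist_eq_norm_of_nearest hp hn
  by_cases hq : q ∈ K
  · obtain ⟨u, hu⟩ := exists_outerNormal hK hi hp
    refine ⟨u, hu, ?_⟩
    rw [boundarySignedDist_of_mem hq, hdist]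
    set d := ‖q - p‖ with hd
    -- The disc of radius `d` about `q` stays in `K`, so moving from `q` by `d` along `u` does not
    -- cross the support line at `p`. This gives `⟪u, q - p⟫ ≤ -d`, the equality case of
    -- Cauchy–Schwarz.
    have hmem : q + d • u ∈ K := closedBall_infDist_frontier_subset hc hq <| by
      rw [mem_closedBall_iff_norm, add_sub_cancel_left, norm_smul, hu.1, hdist]
      simp [hd]
    have h1 := hu.2 _ hmem
    rw [add_sub_right_comm, inner_add_right, inner_smul_right, real_inner_self_eq_norm_sq,
      hu.1] at h1
    have h2 : ‖q - p + d • u‖ ^ 2 ≤ 0 := by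
      have h4 : d * (⟪u, q - p⟫ + d) ≤ 0 :=
        mul_nonpos_of_nonneg_of_nonpos (norm_nonneg _) (by linarith)
      have h5 : ‖d • u‖ = d := by rw [norm_smul, hu.1, mul_one, hd, norm_norm]
      rw [norm_add_sq_real, h5, inner_smul_right, real_inner_comm, ← hd]
      linarith
    have h3 : q - p + d • u = 0 := by
      have := sq_nonneg ‖q - p + d • u‖
      exact norm_eq_zero.1 (pow_eq_zero_iff two_ne_zero |>.1 (le_antisymm h2 this))
    rw [neg_smul]
    exact eq_neg_of_add_eq_zero_left h3
  · have hpK : p ∈ K := hc.frontier_subset hp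
    have hne : q - p ≠ 0 := fun h => hq (sub_eq_zero.1 h ▸ hpK)
    have hd : 0 < ‖q - p‖ := norm_pos_iff.2 hne
    -- Seen from outside, `p` is nearest in all of `K`, because a segment from `q` into `K` meets
    -- the frontier; so the variational inequality of the metric projection applies.
    have hnK : ∀ x ∈ K, ‖q - p‖ ≤ ‖q - x‖ := fun x hx => by
      obtain ⟨y, hy, hs⟩ := exists_mem_frontier_segment hx hq
      rw [norm_sub_rev q x]
      exact (hn y hy).trans (norm_sub_rev q y ▸ norm_sub_le_of_mem_segment hs)
    have hin : ∀ x ∈ K, ⟪q - p, x - p⟫ ≤ 0 := by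
      rw [← norm_eq_iInf_iff_real_inner_le_zero hK hpK]
      have : Nonempty K := ⟨⟨p, hpK⟩⟩
      refine le_antisymm (le_ciInf fun x => hnK x x.2) ?_
      exact ciInf_le ⟨0, by rintro _ ⟨x, rfl⟩; exact norm_nonneg _⟩ (⟨p, hpK⟩ : K)
    refine ⟨‖q - p‖⁻¹ • (q - p), ⟨norm_smul_inv_norm hne, fun x hx => ?_⟩, ?_⟩
    · rw [inner_smul_left]
      exact mul_nonpos_of_nonneg_of_nonpos (by simp) (hin x hx)
    · rw [boundarySignedDist_of_notMem hq, hdist, smul_smul, mul_inv_cancel₀ hd.ne', one_smul]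

/-- A compact convex set with interior points. -/
structure IsConvexBody (K : Set Plane) : Prop where
  convex : Convex ℝ K
  isCompact : IsCompact K
  interior_nonempty : (interior K).Nonempty

namespace IsConvexBody

variable {K K' : Set Plane}

theorem nonempty (hK : IsConvexBody K) : K.Nonempty := hK.interior_nonempty.mono interior_subset

theorem isCompact_frontier (hK : IsConvexBody K) : IsCompact (frontier K) :=
  hK.isCompact.of_isClosed_subset isClosed_frontier hK.isCompact.isClosed.frontier_subset

theorem frontier_nonempty (hK : IsConvexBody K) : (frontier K).Nonempty := by
  obtain ⟨z, hz, -⟩ := exists_mem_frontier_forall_le hK.isCompact hK.nonempty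
    (u := EuclideanSpace.single 0 1) (by simp)
  exact ⟨z, hz⟩

theorem hausdorffEDist_ne_top (hK : IsConvexBody K) (hK' : IsConvexBody K') :
    Metric.hausdorffEDist (frontier K) (frontier K') ≠ ⊤ :=
  Metric.hausdorffEDist_ne_top_of_nonempty_of_bounded hK.frontier_nonempty hK'.frontier_nonempty
    hK.isCompact_frontier.isBounded hK'.isCompact_frontier.isBounded

/-- Let `u` point from the nearest point of `K'` to `q`. The point `q` is at height `s` above the
support line of `K'` normal to `u`, and `q + r • u` still lies in `K`. So the point of `K` extremal
in direction `u` is at height at least `r + s`, hence at least that far from `K'`. -/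
theorem infDist_add_infDist_le (hK : IsConvexBody K) (hK' : IsConvexBody K') {q : Plane}
    (hq : q ∈ K) (hq' : q ∉ K') :
    Metric.infDist q (frontier K) + Metric.infDist q (frontier K') ≤
      Metric.hausdorffDist (frontier K) (frontier K') := by
  obtain ⟨p, hp, hpd⟩ := hK'.isCompact_frontier.exists_infDist_eq_dist hK'.frontier_nonempty q
  obtain ⟨u, hu, hqu⟩ := exists_outerNormal_of_nearest hK'.convex hK'.isCompact.isClosed
    hK'.interior_nonempty hp (q := q) (fun y hy => by
      rw [← dist_eq_norm, ← hpd, ← dist_eq_norm]; exact Metric.infDist_le_dist_of_mem hy)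
  rw [boundarySignedDist_of_notMem hq'] at hqu
  obtain ⟨z, hz, hmax⟩ := exists_mem_frontier_forall_le hK.isCompact hK.nonempty hu.1
  set r := Metric.infDist q (frontier K) with hr
  set s := Metric.infDist q (frontier K') with hs
  have hr0 : 0 ≤ r := Metric.infDist_nonneg
  have hmem : q + r • u ∈ K := closedBall_infDist_frontier_subset hK.isCompact.isClosed hq <| by
    rw [mem_closedBall_iff_norm, add_sub_cancel_left, norm_smul, hu.1, Real.norm_eq_abs,
      abs_of_nonneg hr0, mul_one]
  have h1 := hmax _ hmem
  have h2 : ⟪u, q⟫ - ⟪u, p⟫ = s := by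
    rw [← inner_sub_right, hqu, inner_smul_right, real_inner_self_eq_norm_sq, hu.1]; simp
  rw [inner_add_right, inner_smul_right, real_inner_self_eq_norm_sq, hu.1] at h1
  refine le_trans ?_ (Metric.infDist_le_hausdorffDist_of_mem hz (hK.hausdorffEDist_ne_top hK'))
  refine (Metric.le_infDist hK'.frontier_nonempty).2 fun {y} hy => ?_
  have h3 := hu.2 y (hK'.isCompact.isClosed.frontier_subset hy)
  have h4 := real_inner_le_norm u (z - y)
  rw [hu.1, one_mul, inner_sub_right] at h4
  rw [inner_sub_right] at h3
  rw [dist_eq_norm]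
  linarith

/-- If `q` is on the same side of both boundaries this is the triangle inequality. On opposite sides
the two distances add up, which is where convexity enters through `infDist_add_infDist_le`. -/
theorem abs_boundarySignedDist_sub_le (hK : IsConvexBody K) (hK' : IsConvexBody K') (q : Plane) :
    |boundarySignedDist K q - boundarySignedDist K' q| ≤
      Metric.hausdorffDist (frontier K) (frontier K') := by
  have h1 := Metric.infDist_le_infDist_add_hausdorffDist (x := q) (hK.hausdorffEDist_ne_top hK')
  have h2 := Metric.infDist_le_infDist_add_hausdorffDist (x := q) (hK'.hausdorffEDist_ne_top hK)
  rw [Metric.hausdorffDist_comm] at h2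
  have hr : 0 ≤ Metric.infDist q (frontier K) := Metric.infDist_nonneg
  have hr' : 0 ≤ Metric.infDist q (frontier K') := Metric.infDist_nonneg
  by_cases hq : q ∈ K <;> by_cases hq' : q ∈ K'
  · rw [boundarySignedDist_of_mem hq, boundarySignedDist_of_mem hq', abs_le]
    constructor <;> linarith
  · rw [boundarySignedDist_of_mem hq, boundarySignedDist_of_notMem hq', abs_le]
    have := hK.infDist_add_infDist_le hK' hq hq'
    constructor <;> linarith
  · rw [boundarySignedDist_of_notMem hq, boundarySignedDist_of_mem hq', abs_le]
    have := hK'.infDist_add_infDist_le hK hq' hq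
    rw [Metric.hausdorffDist_comm] at this
    constructor <;> linarith
  · rw [boundarySignedDist_of_notMem hq, boundarySignedDist_of_notMem hq', abs_le]
    constructor <;> linarith

end IsConvexBody

/-! ### Convex curves in polar coordinates -/

theorem plane_inner (x y : Plane) : ⟪x, y⟫ = x 0 * y 0 + x 1 * y 1 := by
  simp [PiLp.inner_apply, Fin.sum_univ_two, mul_comm]

theorem plane_ext {x y : Plane} (h0 : x 0 = y 0) (h1 : x 1 = y 1) : x = y := by
  ext i
  fin_cases i
  · exact h0
  · exact h1

/-- The unit vector with polar angle `φ`. -/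
def unitDir (φ : ℝ) : Plane := !₂[Real.cos φ, Real.sin φ]

theorem unitDir_apply_zero (φ : ℝ) : unitDir φ 0 = Real.cos φ := by simp [unitDir]

theorem unitDir_apply_one (φ : ℝ) : unitDir φ 1 = Real.sin φ := by simp [unitDir]

theorem inner_unitDir (φ ψ : ℝ) : ⟪unitDir φ, unitDir ψ⟫ = Real.cos (φ - ψ) := by
  simp only [plane_inner, unitDir_apply_zero, unitDir_apply_one, Real.cos_sub]

theorem norm_unitDir (φ : ℝ) : ‖unitDir φ‖ = 1 := by
  have h : ‖unitDir φ‖ ^ 2 = 1 := by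
    rw [← real_inner_self_eq_norm_sq, inner_unitDir, sub_self, Real.cos_zero]
  exact (pow_eq_one_iff_of_nonneg (norm_nonneg _) two_ne_zero).1 h

theorem inner_rightNormal_unitDir (φ ψ : ℝ) :
    ⟪rightNormal (unitDir φ), unitDir ψ⟫ = Real.sin (φ - ψ) := by
  rw [plane_inner, Real.sin_sub]
  simp [rightNormal, unitDir]
  ring

theorem rightNormal_smul (a : ℝ) (x : Plane) : rightNormal (a • x) = a • rightNormal x := by
  apply plane_ext <;> simp [rightNormal]

theorem rightNormal_add (x y : Plane) : rightNormal (x + y) = rightNormal x + rightNormal y := by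
  apply plane_ext <;> simp [rightNormal]; ring

theorem rightNormal_neg (x : Plane) : rightNormal (-x) = -rightNormal x := by
  apply plane_ext <;> simp [rightNormal]

theorem inner_rightNormal_self (x : Plane) : ⟪rightNormal x, x⟫ = 0 := by
  simp [plane_inner, rightNormal]; ring

theorem continuous_rightNormal : Continuous rightNormal := by
  unfold rightNormal
  fun_prop

theorem norm_rightNormal (x : Plane) : ‖rightNormal x‖ = ‖x‖ := by
  rw [← sq_eq_sq₀ (norm_nonneg _) (norm_nonneg _), ← real_inner_self_eq_norm_sq,
    ← real_inner_self_eq_norm_sq, plane_inner, plane_inner]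
  simp [rightNormal]; ring

theorem mem_interior_of_sub_eq_smul {K : Set Plane} (hK : Convex ℝ K) {c p q : Plane}
    (hc : c ∈ interior K) (hp : p ∈ K) {l : ℝ} (h0 : 0 ≤ l) (h1 : l < 1)
    (h : q - c = l • (p - c)) : q ∈ interior K := by
  rcases h0.eq_or_lt with rfl | h0
  · rw [zero_smul, sub_eq_zero] at h
    rwa [h]
  · refine hK.openSegment_interior_self_subset_interior hc hp
      ⟨1 - l, l, by linarith, h0, by ring, ?_⟩
    rw [eq_add_of_sub_eq h]
    module

theorem le_of_smul_eq_smul_of_mem_frontier {K : Set Plane} (hK : Convex ℝ K) {c p q : Plane}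
    (hc : c ∈ interior K) (hp : p ∈ K) (hq : q ∈ frontier K) {r s : ℝ} {e : Plane} (hs : 0 ≤ s)
    (h : p - c = r • e) (h' : q - c = s • e) : r ≤ s := by
  by_contra! hlt
  refine hq.2 (mem_interior_of_sub_eq_smul hK hc hp (l := s / r) (div_nonneg hs (hs.trans hlt.le))
    ((div_lt_one (hs.trans_lt hlt)).2 hlt) ?_)
  rw [h, h', smul_smul, div_mul_cancel₀ _ (hs.trans_lt hlt).ne']

/-- `θ` is a counterclockwise polar angle about the inner point `c` of the convex curve `γ`. -/
structure IsPolarAngle (γ : ℝ → Plane) (c : Plane) (θ : ℝ → ℝ) : Prop where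
  closed : IsClosedCurve γ
  convex : IsConvexCurve γ
  mem_interior : c ∈ interior (convexHull ℝ (range γ))
  continuous : Continuous θ
  polar : ∀ t, γ t - c = ‖γ t - c‖ • unitDir (θ t)
  add_one : ∀ t, θ (t + 1) = θ t + 2 * π

theorem IsCounterclockwise.exists_isPolarAngle {γ : ℝ → Plane} (h : IsCounterclockwise γ)
    (hc : IsClosedCurve γ) (hv : IsConvexCurve γ) : ∃ c θ, IsPolarAngle γ c θ := by
  obtain ⟨c, hci, -, θ, hθ, hp, hs⟩ := h
  refine ⟨c, θ, hc, hv, hci, hθ, fun t => ?_, fun t => by simpa using hs t⟩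
  exact sub_eq_iff_eq_add'.2 (hp t)

theorem IsClosedCurve.isCompact_range {γ : ℝ → Plane} (h : IsClosedCurve γ) :
    IsCompact (range γ) :=
  h.periodic.compact_of_continuous one_ne_zero h.continuous

theorem IsClosedCurve.eq_add_int {γ : ℝ → Plane} (h : IsClosedCurve γ) {s t : ℝ}
    (hst : γ s = γ t) : ∃ k : ℤ, s = t + k := by
  have hf : ∀ x, γ (Int.fract x) = γ x := fun x => by
    rw [Int.fract]
    simpa using h.periodic.sub_zsmul_eq (n := ⌊x⌋) (x := x)
  have : Int.fract s = Int.fract t := h.simple ⟨Int.fract_nonneg _, Int.fract_lt_one _⟩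
    ⟨Int.fract_nonneg _, Int.fract_lt_one _⟩ (by rw [hf, hf, hst])
  obtain ⟨k, hk⟩ := Int.fract_eq_fract.1 this
  exact ⟨k, by linarith⟩

namespace IsPolarAngle

variable {γ : ℝ → Plane} {c : Plane} {θ : ℝ → ℝ}

theorem isConvexBody (h : IsPolarAngle γ c θ) : IsConvexBody (convexHull ℝ (range γ)) :=
  have hcl : IsClosed (convexHull ℝ (range γ)) := by
    refine isClosed_of_closure_subset ?_
    rw [closure_eq_interior_union_frontier]
    exact union_subset interior_subset (h.convex ▸ subset_convexHull ℝ _)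
  ⟨convex_convexHull ℝ _, Metric.isCompact_of_isClosed_isBounded hcl
    (isBounded_convexHull.2 h.closed.isCompact_range.isBounded), ⟨c, h.mem_interior⟩⟩

theorem mem_frontier (h : IsPolarAngle γ c θ) (t : ℝ) :
    γ t ∈ frontier (convexHull ℝ (range γ)) := h.convex ▸ mem_range_self t

theorem mem_hull (_ : IsPolarAngle γ c θ) (t : ℝ) : γ t ∈ convexHull ℝ (range γ) :=
  subset_convexHull ℝ _ (mem_range_self t)

/-- A ray from the interior point `c` meets the boundary only once, so equal angles give equal
points and the parameters differ by an integer. The 1-periodicity of `θ t - 2πt` makes that integer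
zero. -/
theorem injective (h : IsPolarAngle γ c θ) : Function.Injective θ := by
  intro s t hst
  have hs := h.polar s
  have ht := h.polar t
  rw [hst] at hs
  have hn : ‖γ s - c‖ = ‖γ t - c‖ := le_antisymm
    (le_of_smul_eq_smul_of_mem_frontier h.isConvexBody.convex h.mem_interior (h.mem_hull s)
      (h.mem_frontier t) (norm_nonneg _) hs ht)
    (le_of_smul_eq_smul_of_mem_frontier h.isConvexBody.convex h.mem_interior (h.mem_hull t)
      (h.mem_frontier s) (norm_nonneg _) ht hs)
  have hγ : γ s = γ t := by
    rw [← sub_left_inj (a := c), hs, ht, hn]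
  obtain ⟨k, hk⟩ := h.closed.eq_add_int hγ
  have hp : Function.Periodic (fun t => θ t - 2 * π * t) 1 := fun t => by
    simp only [h.add_one]; ring
  have hk' := hp.int_mul k t
  simp only [mul_one] at hk'
  rw [← hk, hst] at hk'
  have : (k : ℝ) = 0 := by
    have h2 : 2 * π * (s - t) = 0 := by linarith
    have h3 : s - t = 0 := by
      rcases mul_eq_zero.1 h2 with h4 | h4
      · exact absurd h4 (by positivity)
      · exact h4
    linarith
  rw [hk, this, add_zero]

theorem strictMono (h : IsPolarAngle γ c θ) : StrictMono θ := by
  refine (h.continuous.strictMono_of_inj h.injective).resolve_right fun ha => ?_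
  have h1 := ha (show (0 : ℝ) < 0 + 1 by norm_num)
  rw [h.add_one] at h1
  linarith [Real.pi_pos]

/-- This is the cross product of two radii. Its sign is that of the angle increment, so in the limit
the right normals of both one-sided tangents point weakly away from `c`. -/
theorem inner_rightNormal_sub (h : IsPolarAngle γ c θ) (s t : ℝ) :
    ⟪rightNormal (γ s - γ t), γ t - c⟫ =
      ‖γ s - c‖ * ‖γ t - c‖ * Real.sin (θ s - θ t) := by
  have h1 : γ s - γ t = (γ s - c) + (-(γ t - c)) := by abel
  rw [h1, rightNormal_add, rightNormal_neg, inner_add_left, inner_neg_left,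
    inner_rightNormal_self, neg_zero, add_zero]
  conv_lhs => rw [h.polar s, h.polar t]
  rw [rightNormal_smul, inner_smul_left, inner_smul_right, inner_rightNormal_unitDir]
  simp only [conj_trivial]
  ring

theorem inner_rightNormal_rightTangent_nonneg (h : IsPolarAngle γ c θ) {t : ℝ} {T : Plane}
    (hT : HasRightTangent γ t T) : 0 ≤ ⟪rightNormal T, γ t - c⟫ := by
  have hlim : Tendsto (fun s => ⟪rightNormal (‖γ s - γ t‖⁻¹ • (γ s - γ t)), γ t - c⟫) (𝓝[>] t)
      (𝓝 ⟪rightNormal T, γ t - c⟫) :=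
    ((continuous_rightNormal.tendsto T).comp hT).inner tendsto_const_nhds
  refine ge_of_tendsto hlim ?_
  have hev : ∀ᶠ s in 𝓝 t, θ s < θ t + π :=
    h.continuous.continuousAt.eventually_lt continuousAt_const (by linarith [Real.pi_pos])
  filter_upwards [hev.filter_mono nhdsWithin_le_nhds, self_mem_nhdsWithin] with s hs hst
  rw [rightNormal_smul, inner_smul_left, h.inner_rightNormal_sub]
  have := Real.sin_nonneg_of_nonneg_of_le_pi (x := θ s - θ t)
    (by linarith [h.strictMono hst]) (by linarith)
  simp only [conj_trivial]
  positivity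

theorem inner_rightNormal_leftTangent_nonneg (h : IsPolarAngle γ c θ) {t : ℝ} {T : Plane}
    (hT : HasLeftTangent γ t T) : 0 ≤ ⟪rightNormal T, γ t - c⟫ := by
  have hlim : Tendsto (fun s => ⟪rightNormal (‖γ t - γ s‖⁻¹ • (γ t - γ s)), γ t - c⟫) (𝓝[<] t)
      (𝓝 ⟪rightNormal T, γ t - c⟫) :=
    ((continuous_rightNormal.tendsto T).comp hT).inner tendsto_const_nhds
  refine ge_of_tendsto hlim ?_
  have hev : ∀ᶠ s in 𝓝 t, θ t - π < θ s :=
    continuousAt_const.eventually_lt h.continuous.continuousAt (by linarith [Real.pi_pos])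
  filter_upwards [hev.filter_mono nhdsWithin_le_nhds, self_mem_nhdsWithin] with s hs hst
  rw [rightNormal_smul, inner_smul_left, ← neg_sub (γ s), rightNormal_neg, inner_neg_left,
    h.inner_rightNormal_sub]
  have := Real.sin_nonneg_of_nonneg_of_le_pi (x := θ t - θ s)
    (by linarith [h.strictMono hst]) (by linarith)
  rw [← neg_sub (θ t), Real.sin_neg]
  simp only [conj_trivial, mul_neg, neg_neg, norm_neg]
  positivity

theorem inner_nonneg_of_mem_normalSet (h : IsPolarAngle γ c θ) {t : ℝ} {n : Plane}
    (hn : n ∈ normalSet γ t) : 0 ≤ ⟪n, γ t - c⟫ := by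
  obtain ⟨-, T₁, T₂, h1, h2, a, b, ha, hb, rfl⟩ := hn
  rw [inner_add_left, inner_smul_left, inner_smul_left]
  have := h.inner_rightNormal_leftTangent_nonneg h1
  have := h.inner_rightNormal_rightTangent_nonneg h2
  simp only [conj_trivial]
  positivity

theorem inner_rightTangent_nonpos (h : IsPolarAngle γ c θ) {t : ℝ} {T u : Plane}
    (hu : IsOuterNormal (convexHull ℝ (range γ)) (γ t) u) (hT : HasRightTangent γ t T) :
    ⟪u, T⟫ ≤ 0 := by
  refine le_of_tendsto (tendsto_const_nhds.inner hT) (Eventually.of_forall fun s => ?_)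
  rw [inner_smul_right]
  exact mul_nonpos_of_nonneg_of_nonpos (by positivity) (hu.2 _ (h.mem_hull s))

theorem inner_leftTangent_nonneg (h : IsPolarAngle γ c θ) {t : ℝ} {T u : Plane}
    (hu : IsOuterNormal (convexHull ℝ (range γ)) (γ t) u) (hT : HasLeftTangent γ t T) :
    0 ≤ ⟪u, T⟫ := by
  refine ge_of_tendsto (tendsto_const_nhds.inner hT) (Eventually.of_forall fun s => ?_)
  rw [inner_smul_right, ← neg_sub, inner_neg_right]
  have := hu.2 _ (h.mem_hull s)
  exact mul_nonneg (by positivity) (by linarith)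

theorem norm_eq_one_of_tendsto {α : Type*} {l : Filter α} [l.NeBot] {f : α → Plane} {T : Plane}
    (hT : Tendsto (fun s => ‖f s‖⁻¹ • f s) l (𝓝 T)) (hf : ∀ᶠ s in l, f s ≠ 0) : ‖T‖ = 1 :=
  tendsto_nhds_unique hT.norm
    (tendsto_const_nhds.congr' (hf.mono fun _ hs => (norm_smul_inv_norm (𝕜 := ℝ) hs).symm))

theorem eventually_ne (h : IsPolarAngle γ c θ) (t : ℝ) : ∀ᶠ s in 𝓝 t, s ≠ t → γ s ≠ γ t := by
  filter_upwards [Metric.ball_mem_nhds t one_pos] with s hs hst heq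
  obtain ⟨k, hk⟩ := h.closed.eq_add_int heq
  have h1 : |(k : ℝ)| < 1 := by
    rw [Metric.mem_ball, Real.dist_eq, hk, add_sub_cancel_left] at hs
    exact hs
  have h2 : k = 0 := by
    rw [← Int.cast_abs] at h1
    exact Int.abs_lt_one_iff.1 (by exact_mod_cast h1)
  exact hst (by rw [hk, h2]; simp)

theorem norm_rightTangent (h : IsPolarAngle γ c θ) {t : ℝ} {T : Plane}
    (hT : HasRightTangent γ t T) : ‖T‖ = 1 := by
  refine norm_eq_one_of_tendsto hT ?_
  filter_upwards [(h.eventually_ne t).filter_mono nhdsWithin_le_nhds, self_mem_nhdsWithin]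
    with s hs hst
  exact sub_ne_zero.2 (hs (ne_of_gt hst))

theorem norm_leftTangent (h : IsPolarAngle γ c θ) {t : ℝ} {T : Plane}
    (hT : HasLeftTangent γ t T) : ‖T‖ = 1 := by
  refine norm_eq_one_of_tendsto hT ?_
  filter_upwards [(h.eventually_ne t).filter_mono nhdsWithin_le_nhds, self_mem_nhdsWithin]
    with s hs hst
  exact sub_ne_zero.2 (hs (ne_of_lt hst)).symm

/-- The right tangent does not point into the interior of the convex hull. -/
theorem rightTangent_ne_smul (h : IsPolarAngle γ c θ) {t : ℝ} {T : Plane}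
    (hT : HasRightTangent γ t T) {l : ℝ} (hl : 0 < l) : c ≠ γ t + l • T := by
  intro hcl
  have hK := h.isConvexBody.convex
  have hlim : Tendsto (fun s => γ t + l • (‖γ s - γ t‖⁻¹ • (γ s - γ t))) (𝓝[>] t) (𝓝 c) := by
    rw [hcl]
    exact tendsto_const_nhds.add (hT.const_smul l)
  have hint := hlim.eventually_mem (isOpen_interior.mem_nhds h.mem_interior)
  have hsmall : ∀ᶠ s in 𝓝 t, ‖γ s - γ t‖ < l := by
    have : Continuous fun s => ‖γ s - γ t‖ := (h.closed.continuous.sub continuous_const).norm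
    exact this.continuousAt.eventually_lt continuousAt_const (by simpa using hl)
  obtain ⟨s, hs, hsl, hne, hst⟩ := (hint.and ((hsmall.filter_mono nhdsWithin_le_nhds).and
    (((h.eventually_ne t).filter_mono nhdsWithin_le_nhds).and self_mem_nhdsWithin))).exists
  have hd : 0 < ‖γ s - γ t‖ := norm_pos_iff.2 (sub_ne_zero.2 (hne (ne_of_gt hst)))
  -- For `s` near `t` the point at distance `l` along the secant is close to `c`, hence interior; `γ
  -- s` lies strictly between it and `γ t`, so it would be interior too.
  refine (h.mem_frontier s).2 (hK.openSegment_self_interior_subset_interior (h.mem_hull t) hs ?_)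
  refine ⟨1 - ‖γ s - γ t‖ / l, ‖γ s - γ t‖ / l, sub_pos.2 ((div_lt_one hl).2 hsl),
    div_pos hd hl, by ring, ?_⟩
  rw [smul_add, smul_smul, smul_smul, div_mul_cancel₀ _ hl.ne', mul_inv_cancel₀ hd.ne']
  module

/-- Since the curve stays on one side of the support line, `⟪u, T₁⟫ ≥ 0 ≥ ⟪u, T₂⟫`. Thus `⟪u, T₁⟫ •
rightNormal T₂ - ⟪u, T₂⟫ • rightNormal T₁` has nonnegative coefficients, and it is parallel to `u`;
pairing with `γ t - c` shows that it is a positive multiple. If one of the tangents lies on the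
support line, its normal alone is `u`. -/
theorem mem_normalSet (h : IsPolarAngle γ c θ) {t : ℝ} {u : Plane}
    (hu : IsOuterNormal (convexHull ℝ (range γ)) (γ t) u) : u ∈ normalSet γ t := by
  obtain ⟨T₁, h1⟩ := h.closed.left_tangent t
  obtain ⟨T₂, h2⟩ := h.closed.right_tangent t
  refine ⟨hu.1, T₁, T₂, h1, h2, ?_⟩
  have hu1 : u 0 * u 0 + u 1 * u 1 = 1 := by
    rw [← plane_inner, real_inner_self_eq_norm_sq, hu.1, one_pow]
  have huc : 0 < ⟪u, γ t - c⟫ := by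
    have := hu.inner_neg_of_mem_interior h.mem_interior
    rw [← neg_sub, inner_neg_right] at this
    linarith
  have horth : ∀ w : Plane, ⟪rightNormal u, w⟫ = 0 → w = ⟪u, w⟫ • u := by
    intro w hw
    simp only [plane_inner, rightNormal] at hw ⊢
    simp at hw
    apply plane_ext
    · simp
      linear_combination (-(w 0)) * hu1 + u 1 * hw
    · simp
      linear_combination (-(w 1)) * hu1 - u 0 * hw
  have hpar : ∀ T : Plane, ⟪rightNormal u, rightNormal T⟫ = ⟪u, T⟫ := by
    intro T
    simp [plane_inner, rightNormal]; ring
  have hsingle : ∀ T : Plane, ‖T‖ = 1 → ⟪u, T⟫ = 0 → 0 ≤ ⟪rightNormal T, γ t - c⟫ →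
      u = rightNormal T := by
    intro T hT h0 hpos
    have hk := horth (rightNormal T) (by rw [hpar, h0])
    set k := ⟪u, rightNormal T⟫ with hkdef
    have hk1 : |k| = 1 := by
      have := congrArg norm hk
      rw [norm_rightNormal, hT, norm_smul, hu.1, Real.norm_eq_abs, mul_one] at this
      exact this.symm
    rw [hk, inner_smul_left] at hpos
    have hk0 : 0 ≤ k := by
      by_contra! hneg
      simp only [conj_trivial] at hpos
      nlinarith
    rw [abs_of_nonneg hk0] at hk1
    rw [hk, hk1, one_smul]
  have hb1 := h.inner_leftTangent_nonneg hu h1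
  have hb2 := h.inner_rightTangent_nonpos hu h2
  have hd1 := h.inner_rightNormal_leftTangent_nonneg h1
  have hd2 := h.inner_rightNormal_rightTangent_nonneg h2
  rcases hb2.eq_or_lt with hb2 | hb2
  · exact ⟨0, 1, le_rfl, zero_le_one, by
      rw [← hsingle T₂ (h.norm_rightTangent h2) hb2 hd2]; simp⟩
  rcases hb1.eq_or_lt with hb1 | hb1
  · exact ⟨1, 0, zero_le_one, le_rfl, by
      rw [← hsingle T₁ (h.norm_leftTangent h1) hb1.symm hd1]; simp⟩
  have hd2' : 0 < ⟪rightNormal T₂, γ t - c⟫ := by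
    refine lt_of_le_of_ne hd2 fun h0 => ?_
    -- then `γ t - c` is a multiple of `T₂`
    have hT2 : T₂ 0 * T₂ 0 + T₂ 1 * T₂ 1 = 1 := by
      rw [← plane_inner, real_inner_self_eq_norm_sq, h.norm_rightTangent h2, one_pow]
    have hw : γ t - c = ⟪T₂, γ t - c⟫ • T₂ := by
      set w := γ t - c
      simp only [plane_inner, rightNormal] at h0 ⊢
      simp at h0
      apply plane_ext
      · simp
        linear_combination (-(w 0)) * hT2 - T₂ 1 * h0
      · simp
        linear_combination (-(w 1)) * hT2 + T₂ 0 * h0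
    have hneg : ⟪T₂, γ t - c⟫ < 0 := by
      rw [hw, inner_smul_right] at huc
      by_contra! hge
      nlinarith
    -- Otherwise the right tangent at `γ t` would point straight at the interior point `c`.
    refine h.rightTangent_ne_smul h2 (neg_pos.2 hneg) ?_
    rw [neg_smul, ← hw]
    abel
  set w := ⟪u, T₁⟫ • rightNormal T₂ + (-⟪u, T₂⟫) • rightNormal T₁ with hw
  have hwu := horth w (by
    rw [hw, inner_add_right, inner_smul_right, inner_smul_right, hpar, hpar]; ring)
  have hwpos : 0 < ⟪w, γ t - c⟫ := by
    rw [hw, inner_add_left, inner_smul_left, inner_smul_left]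
    simp only [conj_trivial]
    have := mul_pos hb1 hd2'
    have := mul_nonneg (neg_pos.2 hb2).le hd1
    linarith
  have hk : 0 < ⟪u, w⟫ := by
    rw [hwu, inner_smul_left] at hwpos
    simp only [conj_trivial] at hwpos
    exact pos_of_mul_pos_left hwpos huc.le
  refine ⟨-⟪u, T₂⟫ / ⟪u, w⟫, ⟪u, T₁⟫ / ⟪u, w⟫, div_nonneg (neg_pos.2 hb2).le hk.le,
    div_nonneg hb1.le hk.le, ?_⟩
  have h3 : u = (⟪u, w⟫)⁻¹ • w := by
    conv_rhs => rw [hwu]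
    rw [inner_smul_right, real_inner_self_eq_norm_sq, hu.1, one_pow, mul_one, smul_smul,
      inv_mul_cancel₀ hk.ne', one_smul]
  conv_lhs => rw [h3, hw]
  rw [smul_add, smul_smul, smul_smul, add_comm, div_eq_inv_mul, div_eq_inv_mul]

end IsPolarAngle

/-! ### Reversal of curves -/

theorem tendsto_neg_nhdsWithin_Ioi (t : ℝ) :
    Tendsto (fun s : ℝ => -s) (𝓝[>] t) (𝓝[<] (-t)) :=
  tendsto_nhdsWithin_iff.2 ⟨(continuous_neg.tendsto t).mono_left nhdsWithin_le_nhds,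
    by filter_upwards [self_mem_nhdsWithin] with s hs; exact neg_lt_neg (mem_Ioi.1 hs)⟩

theorem tendsto_neg_nhdsWithin_Iio (t : ℝ) :
    Tendsto (fun s : ℝ => -s) (𝓝[<] t) (𝓝[>] (-t)) :=
  tendsto_nhdsWithin_iff.2 ⟨(continuous_neg.tendsto t).mono_left nhdsWithin_le_nhds,
    by filter_upwards [self_mem_nhdsWithin] with s hs; exact neg_lt_neg (mem_Iio.1 hs)⟩

theorem HasLeftTangent.comp_neg {γ : ℝ → Plane} {t : ℝ} {T : Plane}
    (h : HasLeftTangent γ (-t) T) : HasRightTangent (fun s => γ (-s)) t (-T) := by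
  refine ((h.comp (tendsto_neg_nhdsWithin_Ioi t)).neg).congr fun s => ?_
  simp only [Function.comp_apply]
  rw [norm_sub_rev, ← smul_neg, neg_sub]

theorem HasRightTangent.comp_neg {γ : ℝ → Plane} {t : ℝ} {T : Plane}
    (h : HasRightTangent γ (-t) T) : HasLeftTangent (fun s => γ (-s)) t (-T) := by
  refine ((h.comp (tendsto_neg_nhdsWithin_Iio t)).neg).congr fun s => ?_
  simp only [Function.comp_apply]
  rw [norm_sub_rev, ← smul_neg, neg_sub]

theorem neg_mem_normalSet_comp_neg {γ : ℝ → Plane} {t : ℝ} {n : Plane}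
    (h : n ∈ normalSet γ (-t)) : -n ∈ normalSet (fun s => γ (-s)) t := by
  obtain ⟨hn, T₁, T₂, h1, h2, a, b, ha, hb, rfl⟩ := h
  refine ⟨by rw [norm_neg, hn], -T₂, -T₁, h2.comp_neg, h1.comp_neg, b, a, hb, ha, ?_⟩
  rw [rightNormal_neg, rightNormal_neg]
  module

theorem range_comp_neg (γ : ℝ → Plane) : range (fun s => γ (-s)) = range γ :=
  (Equiv.neg ℝ).surjective.range_comp γ

theorem IsClosedCurve.comp_neg {γ : ℝ → Plane} (h : IsClosedCurve γ) :
    IsClosedCurve fun s => γ (-s) where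
  continuous := h.continuous.comp continuous_neg
  periodic := fun t => by
    have := h.periodic (-(t + 1))
    rw [show -(t + 1) + 1 = -t by ring] at this
    exact this.symm
  simple := by
    intro s hs t ht hst
    obtain ⟨k, hk⟩ := h.eq_add_int hst
    have h1 : |(k : ℝ)| < 1 := by
      rw [abs_lt]
      constructor <;> linarith [hs.1, hs.2, ht.1, ht.2]
    have h2 : k = 0 := by
      rw [← Int.cast_abs] at h1
      exact Int.abs_lt_one_iff.1 (by exact_mod_cast h1)
    rw [h2] at hk
    simpa using hk
  regular_ae := by
    have := (Measure.measurePreserving_neg (volume : Measure ℝ)).quasiMeasurePreserving.ae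
      h.regular_ae
    filter_upwards [this] with t ⟨T, h1, h2⟩
    exact ⟨-T, h2.comp_neg, h1.comp_neg⟩
  left_tangent := fun t => by
    obtain ⟨T, hT⟩ := h.right_tangent (-t)
    exact ⟨-T, hT.comp_neg⟩
  right_tangent := fun t => by
    obtain ⟨T, hT⟩ := h.left_tangent (-t)
    exact ⟨-T, hT.comp_neg⟩

theorem IsConvexCurve.comp_neg {γ : ℝ → Plane} (h : IsConvexCurve γ) :
    IsConvexCurve fun s => γ (-s) := by
  rw [IsConvexCurve, range_comp_neg]
  exact h

theorem IsClockwise.comp_neg {γ : ℝ → Plane} (h : IsClockwise γ) :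
    IsCounterclockwise fun s => γ (-s) := by
  obtain ⟨c, hc, hcr, θ, hθ, hp, hs⟩ := h
  refine ⟨c, by rwa [range_comp_neg], by rwa [range_comp_neg], fun t => θ (-t),
    hθ.comp continuous_neg, fun t => hp (-t), fun t => ?_⟩
  have := hs (-(t + 1))
  rw [show -(t + 1) + 1 = -t by ring] at this
  simp only [this]
  push_cast
  ring

/-! ### The features of convex curves -/

/-- The curve `γ` is the boundary of a convex body, and its normal vectors are the outer normal
vectors of that body if `e = 1`, the inner ones if `e = -1`. -/
structure IsOrientedBoundary (γ : ℝ → Plane) (e : ℝ) : Prop where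
  isConvexBody : IsConvexBody (convexHull ℝ (range γ))
  range_eq : range γ = frontier (convexHull ℝ (range γ))
  sign : e = 1 ∨ e = -1
  smul_mem : ∀ t u, IsOuterNormal (convexHull ℝ (range γ)) (γ t) u → e • u ∈ normalSet γ t
  nonneg : ∃ c ∈ interior (convexHull ℝ (range γ)), ∀ t, ∀ n ∈ normalSet γ t,
    0 ≤ e * ⟪n, γ t - c⟫

theorem IsPolarAngle.isOrientedBoundary {γ : ℝ → Plane} {c : Plane} {θ : ℝ → ℝ}
    (h : IsPolarAngle γ c θ) : IsOrientedBoundary γ 1 where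
  isConvexBody := h.isConvexBody
  range_eq := h.convex
  sign := Or.inl rfl
  smul_mem := fun t u hu => by rw [one_smul]; exact h.mem_normalSet hu
  nonneg := ⟨c, h.mem_interior, fun t n hn => by
    rw [one_mul]; exact h.inner_nonneg_of_mem_normalSet hn⟩

theorem IsPolarAngle.isOrientedBoundary_neg {γ : ℝ → Plane} {c : Plane} {θ : ℝ → ℝ}
    (h : IsPolarAngle (fun s => γ (-s)) c θ) : IsOrientedBoundary γ (-1) where
  isConvexBody := range_comp_neg γ ▸ h.isConvexBody
  range_eq := range_comp_neg γ ▸ h.convex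
  sign := Or.inr rfl
  smul_mem := fun t u hu => by
    rw [← range_comp_neg] at hu
    have h1 := h.mem_normalSet (t := -t) (by simpa only [neg_neg] using hu)
    have h2 := neg_mem_normalSet_comp_neg h1
    simp only [neg_neg] at h2
    simpa using h2
  nonneg := ⟨c, range_comp_neg γ ▸ h.mem_interior, fun t n hn => by
    have h1 := h.inner_nonneg_of_mem_normalSet
      (neg_mem_normalSet_comp_neg (t := -t) (by rwa [neg_neg]))
    rw [neg_neg, inner_neg_left] at h1
    linarith⟩

/-- Equality in Cauchy–Schwarz gives `n = ±u`. As `⟪u, p - c⟫` is strictly positive, `hpos` selects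
the sign. -/
theorem IsOuterNormal.eq_sign_of_abs_inner {K : Set Plane} {p u n c : Plane} {e : ℝ}
    (hu : IsOuterNormal K p u) (hc : c ∈ interior K) (he : e = 1 ∨ e = -1) (hn : ‖n‖ = 1)
    (hpos : 0 ≤ e * ⟪n, p - c⟫) (habs : 1 ≤ |⟪n, u⟫|) : ⟪n, u⟫ = e := by
  have huc : 0 < ⟪u, p - c⟫ := by
    have := hu.inner_neg_of_mem_interior hc
    rw [← neg_sub, inner_neg_right] at this
    linarith
  have hle : |⟪n, u⟫| ≤ 1 := by simpa [hn, hu.1] using abs_real_inner_le_norm n u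
  have h1 := le_antisymm hle habs
  rcases eq_or_eq_neg_of_abs_eq h1 with h | h
  · have hnu := (inner_eq_one_iff_of_norm_eq_one (𝕜 := ℝ) hn hu.1).1 h
    rcases he with rfl | rfl
    · exact h
    · rw [hnu] at hpos
      linarith
  · have hnu := (inner_eq_one_iff_of_norm_eq_one (𝕜 := ℝ) (x := -n) (by rwa [norm_neg]) hu.1).1
      (by rw [inner_neg_left, h, neg_neg])
    rcases he with rfl | rfl
    · rw [← neg_neg n, hnu, inner_neg_left] at hpos
      linarith
    · exact h

namespace IsOrientedBoundary

variable {γ : ℝ → Plane} {e : ℝ}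

theorem argminParam_spec (h : IsOrientedBoundary γ e) (q : Plane) (s : ℝ) :
    ‖q - γ (argminParam γ q)‖ ≤ ‖q - γ s‖ := by
  have hex : ∃ t, ∀ s, ‖q - γ t‖ ≤ ‖q - γ s‖ := by
    obtain ⟨_, hp, hmin⟩ := h.isConvexBody.isCompact_frontier.exists_infDist_eq_dist
      h.isConvexBody.frontier_nonempty q
    rw [← h.range_eq] at hp hmin
    obtain ⟨t, rfl⟩ := hp
    refine ⟨t, fun s => ?_⟩
    rw [← dist_eq_norm, ← dist_eq_norm, ← hmin]
    exact Metric.infDist_le_dist_of_mem (mem_range_self s)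
  exact Classical.epsilon_spec hex s

theorem exists_outerNormal_nearestPoint (h : IsOrientedBoundary γ e) (q : Plane) :
    ∃ u, IsOuterNormal (convexHull ℝ (range γ)) (nearestPoint γ q) u ∧
      q - nearestPoint γ q = boundarySignedDist (convexHull ℝ (range γ)) q • u := by
  refine exists_outerNormal_of_nearest h.isConvexBody.convex h.isConvexBody.isCompact.isClosed
    h.isConvexBody.interior_nonempty ?_ ?_
  · rw [← h.range_eq]
    exact mem_range_self _
  · rw [← h.range_eq]
    rintro _ ⟨s, rfl⟩
    exact h.argminParam_spec q s

theorem norm_sub_nearestPoint (h : IsOrientedBoundary γ e) (q : Plane) :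
    ‖q - nearestPoint γ q‖ = |boundarySignedDist (convexHull ℝ (range γ)) q| := by
  obtain ⟨u, hu, hq⟩ := h.exists_outerNormal_nearestPoint q
  rw [hq, norm_smul, hu.1, mul_one, Real.norm_eq_abs]

theorem inner_nearestNormal (h : IsOrientedBoundary γ e) (q : Plane) :
    ⟪nearestNormal γ q, q - nearestPoint γ q⟫ =
      e * boundarySignedDist (convexHull ℝ (range γ)) q := by
  obtain ⟨u, hu, hq⟩ := h.exists_outerNormal_nearestPoint q
  have hmem := h.smul_mem _ u hu
  have habs : |e| = 1 := by rcases h.sign with rfl | rfl <;> simp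
  have hex : ∃ u, u ∈ normalSet γ (argminParam γ q) ∧ ∀ w ∈ normalSet γ (argminParam γ q),
      |⟪w, q - nearestPoint γ q⟫| ≤ |⟪u, q - nearestPoint γ q⟫| := by
    refine ⟨e • u, hmem, fun w hw => ?_⟩
    rw [hq, inner_smul_right, inner_smul_right, inner_smul_left, real_inner_self_eq_norm_sq, hu.1,
      abs_mul, abs_mul]
    simp only [conj_trivial, one_pow, mul_one, habs]
    exact mul_le_of_le_one_right (abs_nonneg _)
      (by simpa [hw.1, hu.1] using abs_real_inner_le_norm w u)
  obtain ⟨hn, hmax⟩ := Classical.epsilon_spec hex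
  change nearestNormal γ q ∈ _ at hn
  change ∀ w ∈ _, _ ≤ |⟪nearestNormal γ q, q - nearestPoint γ q⟫| at hmax
  have h1 := hmax _ hmem
  rw [hq] at h1 ⊢
  rw [inner_smul_right] at h1 ⊢
  rw [inner_smul_right, inner_smul_left, real_inner_self_eq_norm_sq, hu.1, abs_mul, abs_mul] at h1
  simp only [conj_trivial, one_pow, habs] at h1
  obtain ⟨c, hc, hnn⟩ := h.nonneg
  -- On the curve itself every normal is a maximizer, but both sides vanish.
  rcases eq_or_ne (boundarySignedDist (convexHull ℝ (range γ)) q) 0 with h0 | h0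
  · rw [h0]; simp
  · rw [hu.eq_sign_of_abs_inner hc h.sign hn.1 (hnn _ _ hn)
      (le_of_mul_le_mul_left (by simpa using h1) (abs_pos.2 h0)), mul_comm]

theorem largeScaleFeature_eq (h : IsOrientedBoundary γ e) (σ : ℝ) (q : Plane) :
    largeScaleFeature σ γ q = e * (1 / σ * boundarySignedDist (convexHull ℝ (range γ)) q) := by
  rw [largeScaleFeature, h.inner_nearestNormal]
  ring

theorem feature_eq (h : IsOrientedBoundary γ e) (σ : ℝ) (q : Plane) :
    feature σ γ q = e * (1 / σ * (boundarySignedDist (convexHull ℝ (range γ)) q *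
      Real.exp (-(boundarySignedDist (convexHull ℝ (range γ)) q ^ 2 / σ ^ 2)))) := by
  rw [feature, h.inner_nearestNormal, h.norm_sub_nearestPoint, sq_abs]
  ring

end IsOrientedBoundary

theorem SameOrientation.exists_isOrientedBoundary {γ γ' : ℝ → Plane} (h : SameOrientation γ γ')
    (hc : IsClosedCurve γ) (hc' : IsClosedCurve γ') (hv : IsConvexCurve γ)
    (hv' : IsConvexCurve γ') : ∃ e, IsOrientedBoundary γ e ∧ IsOrientedBoundary γ' e := by
  rcases h with ⟨h1, h2⟩ | ⟨h1, h2⟩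
  · obtain ⟨c, θ, h⟩ := h1.exists_isPolarAngle hc hv
    obtain ⟨c', θ', h'⟩ := h2.exists_isPolarAngle hc' hv'
    exact ⟨1, h.isOrientedBoundary, h'.isOrientedBoundary⟩
  · obtain ⟨c, θ, h⟩ := h1.comp_neg.exists_isPolarAngle hc.comp_neg hv.comp_neg
    obtain ⟨c', θ', h'⟩ := h2.comp_neg.exists_isPolarAngle hc'.comp_neg hv'.comp_neg
    exact ⟨-1, h.isOrientedBoundary_neg, h'.isOrientedBoundary_neg⟩

/-! ### The distances of the features -/

theorem hasDerivAt_mul_exp_neg_sq (x : ℝ) : HasDerivAt (fun x : ℝ => x * Real.exp (-x ^ 2))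
    ((1 - 2 * x ^ 2) * Real.exp (-x ^ 2)) x := by
  have h1 : HasDerivAt (fun x : ℝ => -x ^ 2) (-(2 * x)) x := by
    simpa using (hasDerivAt_pow 2 x).fun_neg
  refine ((hasDerivAt_id' x).mul h1.exp).congr_deriv ?_
  ring

/-- The derivative `(1 - 2z²) exp(-z²)` is bounded by `1`, because `|1 - 2z²| ≤ exp(z²)`. -/
theorem abs_mul_exp_neg_sq_sub_le (x y : ℝ) :
    |x * Real.exp (-x ^ 2) - y * Real.exp (-y ^ 2)| ≤ |x - y| := by
  have hb : ∀ z : ℝ, ‖(1 - 2 * z ^ 2) * Real.exp (-z ^ 2)‖ ≤ 1 := by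
    intro z
    have h1 : |1 - 2 * z ^ 2| ≤ Real.exp (z ^ 2) := by
      have h2 := Real.add_one_le_exp (z ^ 2)
      have h3 : 1 + z ^ 2 + (z ^ 2) ^ 2 / 2 ≤ Real.exp (z ^ 2) :=
        Real.quadratic_le_exp_of_nonneg (sq_nonneg z)
      rw [abs_le]
      constructor <;> nlinarith [sq_nonneg z, sq_nonneg (z ^ 2 - 1)]
    rw [Real.norm_eq_abs, abs_mul, Real.abs_exp]
    calc _ ≤ Real.exp (z ^ 2) * Real.exp (-z ^ 2) := by gcongr
      _ = 1 := by rw [← Real.exp_add]; simp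
  have := Convex.norm_image_sub_le_of_norm_hasDerivWithin_le (s := univ)
    (fun z _ => (hasDerivAt_mul_exp_neg_sq z).hasDerivWithinAt) (fun z _ => hb z) convex_univ
    (mem_univ y) (mem_univ x)
  simpa using this

theorem abs_gaussian_sub_le {σ : ℝ} (hσ : 0 < σ) (x y : ℝ) :
    |x * Real.exp (-(x ^ 2 / σ ^ 2)) - y * Real.exp (-(y ^ 2 / σ ^ 2))| ≤ |x - y| := by
  have h := abs_mul_exp_neg_sq_sub_le (x / σ) (y / σ)
  rw [← sub_div, abs_div, abs_of_pos hσ, le_div_iff₀ hσ] at h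
  refine le_trans (le_of_eq ?_) h
  conv_rhs => rw [← abs_of_pos hσ, ← abs_mul, abs_of_pos hσ]
  congr 1
  simp only [div_pow]
  field_simp

theorem uniformDensity_pos_iff {Ω : Set Plane} (ho : IsOpen Ω) (hne : Ω.Nonempty)
    (hb : Bornology.IsBounded Ω) (q : Plane) : 0 < uniformDensity Ω q ↔ q ∈ Ω := by
  have hpos : 0 < volume.real Ω :=
    ENNReal.toReal_pos (ho.measure_pos volume hne).ne' hb.measure_lt_top.ne
  by_cases hq : q ∈ Ω
  · simp [uniformDensity, hq, hpos]
  · simp [uniformDensity, hq]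

section

variable {Ω : Set Plane} {γ γ' : ℝ → Plane} {e : ℝ}

theorem IsOrientedBoundary.abs_sub_le_hausdorffDistance (h : IsOrientedBoundary γ e)
    (h' : IsOrientedBoundary γ' e) (q : Plane) :
    |boundarySignedDist (convexHull ℝ (range γ)) q - boundarySignedDist (convexHull ℝ (range γ')) q|
      ≤ hausdorffDistance γ γ' := by
  have := h.isConvexBody.abs_boundarySignedDist_sub_le h'.isConvexBody q
  rwa [← h.range_eq, ← h'.range_eq] at this

theorem landmarkSupDist_le_of_forall {μ v w : Plane → ℝ} {D : ℝ} (hD : 0 ≤ D)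
    (h : ∀ q, |v q - w q| ≤ D) : landmarkSupDist μ v w ≤ D :=
  Real.iSup_le (fun q => h q) hD

/-- A lower bound for the distance of two feature functions in terms of their values on the two
curves. -/
theorem hausdorffDistance_le_mul_landmarkSupDist {μ v w : Plane → ℝ} {D C : ℝ} (hC : 0 ≤ C)
    (hb : ∀ q, |v q - w q| ≤ D) (hμ : ∀ t, 0 < μ (γ t)) (hμ' : ∀ t, 0 < μ (γ' t))
    (hl : ∀ t, Metric.infDist (γ t) (range γ') ≤ C * |v (γ t) - w (γ t)|)
    (hl' : ∀ t, Metric.infDist (γ' t) (range γ) ≤ C * |v (γ' t) - w (γ' t)|) :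
    hausdorffDistance γ γ' ≤ C * landmarkSupDist μ v w := by
  -- Needed because an unbounded real supremum has the default value `0`.
  have hbdd : BddAbove (range fun q : {x : Plane // 0 < μ x} => |v q - w q|) :=
    ⟨D, by rintro _ ⟨q, rfl⟩; exact hb q⟩
  refine Metric.hausdorffDist_le_of_infDist
    (mul_nonneg hC (Real.iSup_nonneg fun _ => abs_nonneg _)) ?_ ?_
  · rintro _ ⟨t, rfl⟩
    exact (hl t).trans (mul_le_mul_of_nonneg_left
      (le_ciSup hbdd (⟨γ t, hμ t⟩ : {x : Plane // 0 < μ x})) hC)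
  · rintro _ ⟨t, rfl⟩
    exact (hl' t).trans (mul_le_mul_of_nonneg_left
      (le_ciSup hbdd (⟨γ' t, hμ' t⟩ : {x : Plane // 0 < μ x})) hC)

theorem hausdorffDistance_nonneg (γ γ' : ℝ → Plane) : 0 ≤ hausdorffDistance γ γ' :=
  Metric.hausdorffDist_nonneg

theorem IsOrientedBoundary.infDist_le_hausdorffDistance (h : IsOrientedBoundary γ e)
    (h' : IsOrientedBoundary γ' e) (t : ℝ) :
    Metric.infDist (γ t) (range γ') ≤ hausdorffDistance γ γ' := by
  refine Metric.infDist_le_hausdorffDist_of_mem (mem_range_self t) ?_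
  rw [h.range_eq, h'.range_eq]
  exact h.isConvexBody.hausdorffEDist_ne_top h'.isConvexBody

theorem IsOrientedBoundary.boundarySignedDist_self (h : IsOrientedBoundary γ e) (t : ℝ) :
    boundarySignedDist (convexHull ℝ (range γ)) (γ t) = 0 :=
  boundarySignedDist_of_mem_frontier (h.range_eq ▸ mem_range_self t)

theorem IsOrientedBoundary.abs_boundarySignedDist_eq (h : IsOrientedBoundary γ e) (q : Plane) :
    |boundarySignedDist (convexHull ℝ (range γ)) q| = Metric.infDist q (range γ) := by
  rw [abs_boundarySignedDist, ← h.range_eq]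

theorem IsOrientedBoundary.abs_largeScaleFeature_sub (h : IsOrientedBoundary γ e)
    (h' : IsOrientedBoundary γ' e) {σ : ℝ} (hσ : 0 < σ) (q : Plane) :
    |largeScaleFeature σ γ q - largeScaleFeature σ γ' q| =
      1 / σ * |boundarySignedDist (convexHull ℝ (range γ)) q -
        boundarySignedDist (convexHull ℝ (range γ')) q| := by
  have habs : |e| = 1 := by rcases h.sign with rfl | rfl <;> simp
  rw [h.largeScaleFeature_eq, h'.largeScaleFeature_eq, ← mul_sub, ← mul_sub, abs_mul, abs_mul,
    habs, one_mul, abs_of_pos (one_div_pos.2 hσ)]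

theorem IsOrientedBoundary.abs_feature_sub (h : IsOrientedBoundary γ e)
    (h' : IsOrientedBoundary γ' e) {σ : ℝ} (hσ : 0 < σ) (q : Plane) :
    |feature σ γ q - feature σ γ' q| =
      1 / σ * |boundarySignedDist (convexHull ℝ (range γ)) q *
          Real.exp (-(boundarySignedDist (convexHull ℝ (range γ)) q ^ 2 / σ ^ 2)) -
        boundarySignedDist (convexHull ℝ (range γ')) q *
          Real.exp (-(boundarySignedDist (convexHull ℝ (range γ')) q ^ 2 / σ ^ 2))| := by
  have habs : |e| = 1 := by rcases h.sign with rfl | rfl <;> simp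
  rw [h.feature_eq, h'.feature_eq, ← mul_sub, ← mul_sub, abs_mul, abs_mul,
    habs, one_mul, abs_of_pos (one_div_pos.2 hσ)]

theorem largeScaleOrientationDist_eq {μ : Plane → ℝ} (h : IsOrientedBoundary γ e)
    (h' : IsOrientedBoundary γ' e) (hμ : ∀ t, 0 < μ (γ t)) (hμ' : ∀ t, 0 < μ (γ' t))
    {σ : ℝ} (hσ : 0 < σ) :
    largeScaleOrientationDist μ σ γ γ' = 1 / σ * hausdorffDistance γ γ' := by
  have hb : ∀ q, |largeScaleFeature σ γ q - largeScaleFeature σ γ' q| ≤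
      1 / σ * hausdorffDistance γ γ' := fun q => by
    rw [h.abs_largeScaleFeature_sub h' hσ]
    exact mul_le_mul_of_nonneg_left (h.abs_sub_le_hausdorffDistance h' q) (one_div_pos.2 hσ).le
  refine le_antisymm (landmarkSupDist_le_of_forall
    (mul_nonneg (one_div_pos.2 hσ).le (hausdorffDistance_nonneg γ γ')) hb) ?_
  rw [one_div, inv_mul_le_iff₀ hσ]
  refine hausdorffDistance_le_mul_landmarkSupDist hσ.le hb hμ hμ' (fun t => ?_) fun t => ?_
  · rw [h.abs_largeScaleFeature_sub h' hσ, h.boundarySignedDist_self, zero_sub, abs_neg,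
      h'.abs_boundarySignedDist_eq, ← mul_assoc, mul_one_div_cancel hσ.ne', one_mul]
  · rw [h.abs_largeScaleFeature_sub h' hσ, h'.boundarySignedDist_self, sub_zero,
      h.abs_boundarySignedDist_eq, ← mul_assoc, mul_one_div_cancel hσ.ne', one_mul]

theorem IsOrientedBoundary.abs_feature_sub_le (h : IsOrientedBoundary γ e)
    (h' : IsOrientedBoundary γ' e) {σ : ℝ} (hσ : 0 < σ) (q : Plane) :
    |feature σ γ q - feature σ γ' q| ≤ 1 / σ * hausdorffDistance γ γ' := by
  rw [h.abs_feature_sub h' hσ]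
  exact mul_le_mul_of_nonneg_left ((abs_gaussian_sub_le hσ _ _).trans
    (h.abs_sub_le_hausdorffDistance h' q)) (one_div_pos.2 hσ).le

theorem orientationDist_le {μ : Plane → ℝ} (h : IsOrientedBoundary γ e)
    (h' : IsOrientedBoundary γ' e) {σ : ℝ} (hσ : 0 < σ) :
    orientationDist μ σ γ γ' ≤ 1 / σ * hausdorffDistance γ γ' :=
  landmarkSupDist_le_of_forall (mul_nonneg (one_div_pos.2 hσ).le (hausdorffDistance_nonneg γ γ'))
    (h.abs_feature_sub_le h' hσ)

/-- For a landmark on one curve, `v` is the feature difference and `s` the signed distance to the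
other curve. The exponential factor is at least `exp(-D² / σ²)` since `|s| ≤ D`. -/
theorem infDist_le_of_abs_eq {d D σ s v : ℝ} (hσ : 0 < σ) (hd : d ≤ D) (hs : |s| = d)
    (hv : v = 1 / σ * |s * Real.exp (-(s ^ 2 / σ ^ 2))|) :
    d ≤ σ * Real.exp (D ^ 2 / σ ^ 2) * v := by
  have hd0 : 0 ≤ d := hs ▸ abs_nonneg s
  have hsd : s ^ 2 = d ^ 2 := by rw [← hs, sq_abs]
  have h1 : 1 ≤ Real.exp (D ^ 2 / σ ^ 2) * Real.exp (-(d ^ 2 / σ ^ 2)) := by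
    rw [← Real.exp_add]
    refine Real.one_le_exp ?_
    rw [← sub_eq_add_neg, sub_nonneg]
    gcongr
  rw [hv, abs_mul, Real.abs_exp, hs, hsd]
  calc d ≤ d * (Real.exp (D ^ 2 / σ ^ 2) * Real.exp (-(d ^ 2 / σ ^ 2))) :=
        le_mul_of_one_le_right hd0 h1
    _ = _ := by field_simp

theorem le_orientationDist {μ : Plane → ℝ} (h : IsOrientedBoundary γ e)
    (h' : IsOrientedBoundary γ' e) (hμ : ∀ t, 0 < μ (γ t)) (hμ' : ∀ t, 0 < μ (γ' t))
    {σ : ℝ} (hσ : 0 < σ) :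
    Real.exp (-(hausdorffDistance γ γ' ^ 2 / σ ^ 2)) * (1 / σ * hausdorffDistance γ γ') ≤
      orientationDist μ σ γ γ' := by
  have key : hausdorffDistance γ γ' ≤
      σ * Real.exp (hausdorffDistance γ γ' ^ 2 / σ ^ 2) * orientationDist μ σ γ γ' := by
    refine hausdorffDistance_le_mul_landmarkSupDist (by positivity)
      (h.abs_feature_sub_le h' hσ) hμ hμ' (fun t => ?_) fun t => ?_
    · refine infDist_le_of_abs_eq hσ (h.infDist_le_hausdorffDistance h' t)
        (h'.abs_boundarySignedDist_eq _) ?_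
      rw [h.abs_feature_sub h' hσ, h.boundarySignedDist_self, zero_mul, zero_sub, abs_neg]
    · have hle := h'.infDist_le_hausdorffDistance h t
      rw [hausdorffDistance, Metric.hausdorffDist_comm] at hle
      refine infDist_le_of_abs_eq hσ hle (h.abs_boundarySignedDist_eq _) ?_
      rw [h.abs_feature_sub h' hσ, h'.boundarySignedDist_self, zero_mul, sub_zero]
  rw [Real.exp_neg, inv_mul_le_iff₀ (Real.exp_pos _), one_div, inv_mul_le_iff₀ hσ, ← mul_assoc]
  exact key

end

/-! ### The Fréchet distance -/

/-- Each of the two suprema pairs every point of one curve with a point of the other. Both are used,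
since `α` may jump over parameters of `γ'`. -/
theorem hausdorffDistance_le_frechetDistance {γ γ' : ℝ → Plane} (h : IsClosedCurve γ)
    (h' : IsClosedCurve γ') : hausdorffDistance γ γ' ≤ frechetDistance γ γ' := by
  have : Nonempty CircleDeg1Lift := ⟨1⟩
  have hb := h.isCompact_range.isBounded.union h'.isCompact_range.isBounded
  have hle : ∀ s t, ‖γ s - γ' t‖ ≤ Metric.diam (range γ ∪ range γ') := fun s t => by
    rw [← dist_eq_norm]
    exact Metric.dist_le_diam_of_mem hb (Or.inl (mem_range_self s)) (Or.inr (mem_range_self t))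
  refine le_ciInf fun α => ?_
  have h1 : ∀ t, ‖γ t - γ' (α t)‖ ≤ ⨆ t : ℝ, ‖γ t - γ' (α t)‖ := fun t =>
    le_ciSup (f := fun t : ℝ => ‖γ t - γ' (α t)‖)
      ⟨_, by rintro _ ⟨t, rfl⟩; exact hle _ _⟩ t
  have h2 : ∀ t, ‖γ (cyclicInverse α t) - γ' t‖ ≤ ⨆ t : ℝ, ‖γ (cyclicInverse α t) - γ' t‖ :=
    fun t => le_ciSup (f := fun t : ℝ => ‖γ (cyclicInverse α t) - γ' t‖)
      ⟨_, by rintro _ ⟨t, rfl⟩; exact hle _ _⟩ t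
  refine Metric.hausdorffDist_le_of_mem_dist
    ((norm_nonneg _).trans ((h1 0).trans (le_max_left _ _))) ?_ ?_
  · rintro _ ⟨t, rfl⟩
    exact ⟨_, mem_range_self (α t), by
      rw [dist_eq_norm]; exact (h1 t).trans (le_max_left _ _)⟩
  · rintro _ ⟨t, rfl⟩
    exact ⟨_, mem_range_self (cyclicInverse α t), by
      rw [dist_comm, dist_eq_norm]; exact (h2 t).trans (le_max_right _ _)⟩

/-- For a bijective `α` the generalized inverse is the true inverse, so both suprema run over the
same pairs of points. -/
theorem frechetDistance_le_of_orderIso {γ γ' : ℝ → Plane} (f : ℝ ≃o ℝ)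
    (hf : ∀ t, f (t + 1) = f t + 1) {D : ℝ} (hD : ∀ t, ‖γ t - γ' (f t)‖ ≤ D) :
    frechetDistance γ γ' ≤ D := by
  let α : CircleDeg1Lift := ⟨⟨f, f.monotone⟩, hf⟩
  have hinv : ∀ t, cyclicInverse α t = f.symm t := fun t => by
    have : {x | t ≤ α x} = Ici (f.symm t) := by
      ext x
      exact f.symm_apply_le.symm
    rw [cyclicInverse, this, csInf_Ici]
  refine (ciInf_le ⟨0, ?_⟩ α).trans (max_le (ciSup_le hD) (ciSup_le fun t => ?_))
  · rintro _ ⟨β, rfl⟩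
    exact le_max_of_le_left (Real.iSup_nonneg fun _ => norm_nonneg _)
  · rw [hinv]
    simpa using hD (f.symm t)

/-! ### Flows on the line -/

section Flow

variable {V : ℝ → ℝ → ℝ} {K L : ℝ≥0}

theorem ODE_solution_unique_Icc_zero_one (hV : ∀ t ∈ Icc (0 : ℝ) 1, LipschitzWith K (V t))
    {f g : ℝ → ℝ}
    (hf : ∀ t ∈ Icc (0 : ℝ) 1, HasDerivWithinAt f (V t (f t)) (Icc 0 1) t)
    (hg : ∀ t ∈ Icc (0 : ℝ) 1, HasDerivWithinAt g (V t (g t)) (Icc 0 1) t)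
    {t₀ : ℝ} (ht₀ : t₀ ∈ Icc (0 : ℝ) 1) (h : f t₀ = g t₀) : EqOn f g (Icc 0 1) := by
  have hfc : ContinuousOn f (Icc 0 1) := fun t ht => (hf t ht).continuousWithinAt
  have hgc : ContinuousOn g (Icc 0 1) := fun t ht => (hg t ht).continuousWithinAt
  have hl : EqOn f g (Icc 0 t₀) := by
    have hsub : Icc 0 t₀ ⊆ Icc (0 : ℝ) 1 := Icc_subset_Icc_right ht₀.2
    have hm : ∀ t ∈ Ioc 0 t₀, t ∈ Ioc (0 : ℝ) 1 := fun t ht => ⟨ht.1, ht.2.trans ht₀.2⟩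
    exact ODE_solution_unique_of_mem_Icc_left (s := fun _ => univ) (v := V)
      (fun t ht => (hV t (Ioc_subset_Icc_self (hm t ht))).lipschitzOnWith) (hfc.mono hsub)
      (fun t ht => (hf t (Ioc_subset_Icc_self (hm t ht))).mono_of_mem_nhdsWithin
        (Icc_mem_nhdsLE_of_mem (hm t ht))) (fun _ _ => mem_univ _) (hgc.mono hsub)
      (fun t ht => (hg t (Ioc_subset_Icc_self (hm t ht))).mono_of_mem_nhdsWithin
        (Icc_mem_nhdsLE_of_mem (hm t ht))) (fun _ _ => mem_univ _) h
  have hr : EqOn f g (Icc t₀ 1) := by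
    have hsub : Icc t₀ 1 ⊆ Icc (0 : ℝ) 1 := Icc_subset_Icc_left ht₀.1
    have hm : ∀ t ∈ Ico t₀ 1, t ∈ Ico (0 : ℝ) 1 := fun t ht => ⟨ht₀.1.trans ht.1, ht.2⟩
    exact ODE_solution_unique_of_mem_Icc_right (s := fun _ => univ) (v := V)
      (fun t ht => (hV t (Ico_subset_Icc_self (hm t ht))).lipschitzOnWith) (hfc.mono hsub)
      (fun t ht => (hf t (Ico_subset_Icc_self (hm t ht))).mono_of_mem_nhdsWithin
        (Icc_mem_nhdsGE_of_mem (hm t ht))) (fun _ _ => mem_univ _) (hgc.mono hsub)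
      (fun t ht => (hg t (Ico_subset_Icc_self (hm t ht))).mono_of_mem_nhdsWithin
        (Icc_mem_nhdsGE_of_mem (hm t ht))) (fun _ _ => mem_univ _) h
  rw [← Icc_union_Icc_eq_Icc ht₀.1 ht₀.2]
  exact hl.union hr

theorem exists_ODE_solution_Icc_zero_one (hV : ∀ t ∈ Icc (0 : ℝ) 1, LipschitzWith K (V t))
    (hc : ∀ x, ContinuousOn (fun t => V t x) (Icc 0 1))
    (hb : ∀ t ∈ Icc (0 : ℝ) 1, ∀ x, |V t x| ≤ L) {t₀ : ℝ} (ht₀ : t₀ ∈ Icc (0 : ℝ) 1) (x : ℝ) :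
    ∃ f : ℝ → ℝ, f t₀ = x ∧ ∀ t ∈ Icc (0 : ℝ) 1, HasDerivWithinAt f (V t (f t)) (Icc 0 1) t := by
  -- A solution of speed at most `L` moves by at most `L` in time one, so a ball of radius `L`
  -- suffices.
  have hP : IsPicardLindelof V (⟨t₀, ht₀⟩ : Icc (0 : ℝ) 1) x L 0 L K :=
    { lipschitzOnWith := fun t ht => (hV t ht).lipschitzOnWith
      continuousOn := fun x _ => hc x
      norm_le := fun t ht x _ => hb t ht x
      mul_max_le := by
        have : max (1 - t₀) (t₀ - 0) ≤ 1 := max_le (by linarith [ht₀.1]) (by linarith [ht₀.2])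
        simpa using mul_le_of_le_one_right L.2 this }
  exact hP.exists_eq_forall_mem_Icc_hasDerivWithinAt₀

/-- The time one map of a periodic vector field on the line. -/
theorem exists_orderIso_flow (hV : ∀ t ∈ Icc (0 : ℝ) 1, LipschitzWith K (V t))
    (hc : ∀ x, ContinuousOn (fun t => V t x) (Icc 0 1))
    (hb : ∀ t ∈ Icc (0 : ℝ) 1, ∀ x, |V t x| ≤ L) {p : ℝ}
    (hp : ∀ t x, V t (x + p) = V t x) :
    ∃ F : ℝ ≃o ℝ, (∀ x, F (x + p) = F x + p) ∧ ∀ x, ∃ f : ℝ → ℝ, f 0 = x ∧ f 1 = F x ∧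
      ∀ t ∈ Icc (0 : ℝ) 1, HasDerivWithinAt f (V t (f t)) (Icc 0 1) t := by
  have h0 : (0 : ℝ) ∈ Icc (0 : ℝ) 1 := by simp
  have h1 : (1 : ℝ) ∈ Icc (0 : ℝ) 1 := by simp
  choose f hf0 hf using exists_ODE_solution_Icc_zero_one hV hc hb h0
  -- Trajectories cannot cross: a reversed order at time one would force a meeting, against
  -- uniqueness.
  have hmono : StrictMono fun x => f x 1 := by
    intro x y hxy
    by_contra! hle
    have hcont : ContinuousOn (fun t => f y t - f x t) (Icc 0 1) := fun t ht =>
      (hf y t ht).continuousWithinAt.sub (hf x t ht).continuousWithinAt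
    obtain ⟨t, ht, hz⟩ := intermediate_value_Icc' zero_le_one hcont
      (show (0 : ℝ) ∈ Icc _ _ from ⟨sub_nonpos.2 hle, by rw [hf0, hf0]; linarith⟩)
    have := ODE_solution_unique_Icc_zero_one hV (hf y) (hf x) ht (sub_eq_zero.1 hz) h0
    rw [hf0, hf0] at this
    exact hxy.ne' this
  have hsurj : Function.Surjective fun x => f x 1 := by
    intro y
    obtain ⟨g, hg1, hg⟩ := exists_ODE_solution_Icc_zero_one hV hc hb h1 y
    refine ⟨g 0, ?_⟩
    rw [← hg1]
    exact ODE_solution_unique_Icc_zero_one hV (hf _) hg h0 (hf0 _) h1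
  refine ⟨hmono.orderIsoOfSurjective _ hsurj, fun x => ?_, fun x => ⟨f x, hf0 x, rfl, hf x⟩⟩
  refine ODE_solution_unique_Icc_zero_one hV (hf (x + p)) (g := fun t => f x t + p)
    (fun t ht => ?_) h0 (by rw [hf0, hf0]) h1
  rw [hp]
  exact (hf x t ht).add_const p

end Flow

/-! ### Curves with a smooth support function -/

/-- The unit vector field `unitDir` is its own derivative up to a quarter turn. -/
theorem hasDerivAt_unitDir (φ : ℝ) : HasDerivAt unitDir (unitDir (φ + π / 2)) φ := by
  have h : HasDerivAt (fun φ => Real.cos φ • (EuclideanSpace.single 0 1 : Plane) +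
      Real.sin φ • (EuclideanSpace.single 1 1 : Plane)) (-Real.sin φ •
      (EuclideanSpace.single 0 1 : Plane) + Real.cos φ • (EuclideanSpace.single 1 1 : Plane)) φ :=
    ((Real.hasDerivAt_cos φ).smul_const _).add ((Real.hasDerivAt_sin φ).smul_const _)
  have he : ∀ a b : ℝ, a • (EuclideanSpace.single 0 1 : Plane) +
      b • (EuclideanSpace.single 1 1 : Plane) = !₂[a, b] := fun a b => by
    apply plane_ext <;> simp
  simp only [he] at h
  rw [unitDir, Real.cos_add_pi_div_two, Real.sin_add_pi_div_two]
  exact h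

theorem unitDir_add_pi (φ : ℝ) : unitDir (φ + π) = -unitDir φ := by
  apply plane_ext <;> simp [unitDir]

theorem hasDerivAt_unitDir_add_pi_div_two (φ : ℝ) :
    HasDerivAt (fun φ => unitDir (φ + π / 2)) (-unitDir φ) φ := by
  have := (hasDerivAt_unitDir (φ + π / 2)).comp_add_const φ (π / 2)
  rwa [add_assoc, add_halves, unitDir_add_pi] at this

theorem unitDir_add_two_pi (φ : ℝ) : unitDir (φ + 2 * π) = unitDir φ := by
  apply plane_ext <;> simp [unitDir]

/-- `h` is a smooth support function in polar coordinates with positive radius of curvature. -/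
structure IsSmoothSupport (h : ℝ → ℝ) : Prop where
  contDiff : ContDiff ℝ ∞ h
  periodic : Function.Periodic h (2 * π)
  curvature_pos : ∀ φ, 0 < h φ + deriv (deriv h) φ

/-- The point with outer normal `unitDir φ` on the boundary of the convex body with support
function `h`. -/
def supportCurve (h : ℝ → ℝ) (φ : ℝ) : Plane :=
  h φ • unitDir φ + deriv h φ • unitDir (φ + π / 2)

theorem Function.Periodic.deriv_periodic {h : ℝ → ℝ} {p : ℝ} (hp : Function.Periodic h p) :
    Function.Periodic (deriv h) p := fun x => by
  have : (fun y => h (y + p)) = h := funext hp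
  rw [← deriv_comp_add_const, this]

theorem Function.Periodic.exists_bound_lipschitz {f : ℝ → ℝ} {p : ℝ} (hp : Function.Periodic f p)
    (hp0 : p ≠ 0) (hf : ContDiff ℝ ∞ f) :
    ∃ M, 0 ≤ M ∧ (∀ x, |f x| ≤ M) ∧ ∀ x y, |f x - f y| ≤ M * |x - y| := by
  have hd := (contDiff_infty_iff_deriv.1 hf).2
  obtain ⟨M, hM⟩ := (hp.isBounded_of_continuous hp0 hf.continuous).exists_norm_le
  obtain ⟨N, hN⟩ := (hp.deriv_periodic.isBounded_of_continuous hp0 hd.continuous).exists_norm_le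
  have hM' : ∀ x, |f x| ≤ M := fun x => hM _ (mem_range_self x)
  refine ⟨max M N, ((abs_nonneg _).trans (hM' 0)).trans (le_max_left _ _),
    fun x => (hM' x).trans (le_max_left _ _), fun x y => ?_⟩
  refine (Convex.norm_image_sub_le_of_norm_deriv_le (s := univ)
    (fun z _ => (contDiff_infty_iff_deriv.1 hf).1 z) (fun z _ => hN _ (mem_range_self z))
    convex_univ (mem_univ y) (mem_univ x)).trans ?_
  rw [Real.norm_eq_abs]
  gcongr
  exact le_max_right _ _

theorem Function.Periodic.exists_pos_le {f : ℝ → ℝ} {p : ℝ} (hp : Function.Periodic f p)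
    (hp0 : p ≠ 0) (hf : Continuous f) (hpos : ∀ x, 0 < f x) : ∃ m, 0 < m ∧ ∀ x, m ≤ f x := by
  obtain ⟨_, ⟨x, rfl⟩, hx⟩ := (hp.compact_of_continuous hp0 hf).exists_isLeast
    (range_nonempty f)
  exact ⟨f x, hpos x, fun y => hx (mem_range_self y)⟩

theorem abs_div_sub_div_le {a a' b b' A B m d : ℝ} (hm : 0 < m) (hb : m ≤ b) (hb' : m ≤ b')
    (ha' : |a'| ≤ A) (haa : |a - a'| ≤ B * d) (hbb : |b - b'| ≤ B * d) :
    |a / b - a' / b'| ≤ (B / m + A * B / m ^ 2) * d := by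
  have hb0 := hm.trans_le hb
  have hb0' := hm.trans_le hb'
  have hBd := (abs_nonneg _).trans haa
  have hA := (abs_nonneg _).trans ha'
  have h1 : a / b - a' / b' = (a - a') / b - a' * (b - b') / (b * b') := by
    field_simp
    ring
  calc |a / b - a' / b'| ≤ |(a - a') / b| + |a' * (b - b') / (b * b')| := by
        rw [h1]; exact abs_sub _ _
    _ ≤ B * d / m + A * (B * d) / (m * m) := by
        rw [abs_div, abs_div, abs_mul, abs_mul, abs_of_pos hb0, abs_of_pos hb0']
        gcongr
    _ = _ := by ring

namespace IsSmoothSupport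

variable {h h₀ h₁ : ℝ → ℝ}

theorem differentiable (hs : IsSmoothSupport h) : Differentiable ℝ h :=
  (contDiff_infty_iff_deriv.1 hs.contDiff).1

theorem contDiff_deriv (hs : IsSmoothSupport h) : ContDiff ℝ ∞ (deriv h) :=
  (contDiff_infty_iff_deriv.1 hs.contDiff).2

theorem contDiff_curvature (hs : IsSmoothSupport h) :
    ContDiff ℝ ∞ fun φ => h φ + deriv (deriv h) φ :=
  hs.contDiff.add (contDiff_infty_iff_deriv.1 hs.contDiff_deriv).2

theorem periodic_curvature (hs : IsSmoothSupport h) :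
    Function.Periodic (fun φ => h φ + deriv (deriv h) φ) (2 * π) :=
  hs.periodic.add hs.periodic.deriv_periodic.deriv_periodic

theorem hasDerivAt (hs : IsSmoothSupport h) (φ : ℝ) : HasDerivAt h (deriv h φ) φ :=
  (hs.differentiable φ).hasDerivAt

theorem hasDerivAt_deriv (hs : IsSmoothSupport h) (φ : ℝ) :
    HasDerivAt (deriv h) (deriv (deriv h) φ) φ :=
  ((contDiff_infty_iff_deriv.1 hs.contDiff_deriv).1 φ).hasDerivAt

/-- Moving the points of a smooth convex curve along their normal vectors, with normal speed the
difference of the support functions, gives a parametrization of another smooth convex curve. -/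
theorem exists_orderIso_dist_le (hs₀ : IsSmoothSupport h₀) (hs₁ : IsSmoothSupport h₁) {δ : ℝ}
    (hδ : ∀ φ, |h₁ φ - h₀ φ| ≤ δ) :
    ∃ F : ℝ ≃o ℝ, (∀ φ, F (φ + 2 * π) = F φ + 2 * π) ∧
      ∀ φ, ‖supportCurve h₀ φ - supportCurve h₁ (F φ)‖ ≤ δ := by
  have h2π : 2 * π ≠ 0 := by positivity
  set ρ₀ : ℝ → ℝ := fun φ => h₀ φ + deriv (deriv h₀) φ with hρ₀
  set ρ₁ : ℝ → ℝ := fun φ => h₁ φ + deriv (deriv h₁) φ with hρ₁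
  set g : ℝ → ℝ := fun φ => deriv h₁ φ - deriv h₀ φ with hg
  obtain ⟨m₀, hm₀, hle₀⟩ := hs₀.periodic_curvature.exists_pos_le h2π
    hs₀.contDiff_curvature.continuous hs₀.curvature_pos
  obtain ⟨m₁, hm₁, hle₁⟩ := hs₁.periodic_curvature.exists_pos_le h2π
    hs₁.contDiff_curvature.continuous hs₁.curvature_pos
  obtain ⟨A₀, hA₀, -, hl₀⟩ := hs₀.periodic_curvature.exists_bound_lipschitz h2π
    hs₀.contDiff_curvature
  obtain ⟨A₁, hA₁, -, hl₁⟩ := hs₁.periodic_curvature.exists_bound_lipschitz h2π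
    hs₁.contDiff_curvature
  have hgp : Function.Periodic g (2 * π) :=
    hs₁.periodic.deriv_periodic.sub hs₀.periodic.deriv_periodic
  obtain ⟨A, hA, hgb, hgl⟩ := hgp.exists_bound_lipschitz h2π
    (hs₁.contDiff_deriv.sub hs₀.contDiff_deriv)
  set m := min m₀ m₁
  have hm : 0 < m := lt_min hm₀ hm₁
  set B := max A (max A₀ A₁)
  -- Below, `R t` is the radius of curvature for the support function `(1 - t) h₀ + t h₁`; the
  -- constant `m` bounds it from below, and `B` is a common Lipschitz constant for `R t` and `g`.
  have hB : 0 ≤ B := hA.trans (le_max_left _ _)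
  set R : ℝ → ℝ → ℝ := fun t φ => (1 - t) * ρ₀ φ + t * ρ₁ φ with hR
  have hRm : ∀ t ∈ Icc (0 : ℝ) 1, ∀ φ, m ≤ R t φ := fun t ht φ => by
    have e0 : m ≤ ρ₀ φ := (min_le_left _ _).trans (hle₀ φ)
    have e1 : m ≤ ρ₁ φ := (min_le_right _ _).trans (hle₁ φ)
    calc m = (1 - t) * m + t * m := by ring
      _ ≤ _ := add_le_add (mul_le_mul_of_nonneg_left e0 (by linarith [ht.2]))
        (mul_le_mul_of_nonneg_left e1 ht.1)
  have hRl : ∀ t ∈ Icc (0 : ℝ) 1, ∀ x y, |R t x - R t y| ≤ B * |x - y| := fun t ht x y => by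
    have e0 : |ρ₀ x - ρ₀ y| ≤ B * |x - y| := (hl₀ x y).trans (mul_le_mul_of_nonneg_right
      ((le_max_left _ _).trans (le_max_right _ _)) (abs_nonneg _))
    have e1 : |ρ₁ x - ρ₁ y| ≤ B * |x - y| := (hl₁ x y).trans (mul_le_mul_of_nonneg_right
      ((le_max_right _ _).trans (le_max_right _ _)) (abs_nonneg _))
    have h1t : 0 ≤ 1 - t := by linarith [ht.2]
    calc |R t x - R t y| = |(1 - t) * (ρ₀ x - ρ₀ y) + t * (ρ₁ x - ρ₁ y)| := by
          congr 1
          simp only [hR]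
          ring
      _ ≤ (1 - t) * |ρ₀ x - ρ₀ y| + t * |ρ₁ x - ρ₁ y| := by
          refine (abs_add_le _ _).trans ?_
          rw [abs_mul, abs_mul, abs_of_nonneg h1t, abs_of_nonneg ht.1]
      _ ≤ (1 - t) * (B * |x - y|) + t * (B * |x - y|) :=
          add_le_add (mul_le_mul_of_nonneg_left e0 h1t) (mul_le_mul_of_nonneg_left e1 ht.1)
      _ = _ := by ring
  -- The interpolated curve at a moving angle `f t` has tangential velocity `g (f t) + R t (f t) *
  -- f' t`; this field makes it zero, leaving only the normal velocity `h₁ - h₀`.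
  set V : ℝ → ℝ → ℝ := fun t φ => -(g φ / R t φ) with hV
  have hlip : ∀ t ∈ Icc (0 : ℝ) 1,
      LipschitzWith (Real.toNNReal (B / m + A * B / m ^ 2)) (V t) := fun t ht => by
    refine LipschitzWith.of_dist_le_mul fun x y => ?_
    rw [Real.coe_toNNReal _ (by positivity), Real.dist_eq, Real.dist_eq]
    rw [hV, neg_sub_neg, abs_sub_comm]
    exact abs_div_sub_div_le hm (hRm t ht x) (hRm t ht y) (hgb y)
      ((hgl x y).trans (mul_le_mul_of_nonneg_right (le_max_left _ _) (abs_nonneg _)))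
      (hRl t ht x y)
  have hcont : ∀ x, ContinuousOn (fun t => V t x) (Icc 0 1) := fun x => by
    refine (continuousOn_const.div ?_ fun t ht => (hm.trans_le (hRm t ht x)).ne').neg
    simp only [hR]
    fun_prop
  have hbd : ∀ t ∈ Icc (0 : ℝ) 1, ∀ x, |V t x| ≤ Real.toNNReal (A / m) := fun t ht x => by
    rw [Real.coe_toNNReal _ (by positivity), hV, abs_neg, abs_div,
      abs_of_pos (hm.trans_le (hRm t ht x))]
    exact div_le_div₀ hA (hgb x) hm (hRm t ht x)
  have hper : ∀ t x, V t (x + 2 * π) = V t x := fun t x => by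
    have e0 : ρ₀ (x + 2 * π) = ρ₀ x := hs₀.periodic_curvature x
    have e1 : ρ₁ (x + 2 * π) = ρ₁ x := hs₁.periodic_curvature x
    simp only [hV, hR, hgp x, e0, e1]
  obtain ⟨F, hF, hflow⟩ := exists_orderIso_flow hlip hcont hbd hper
  refine ⟨F, hF, fun φ => ?_⟩
  obtain ⟨f, hf0, hf1, hf⟩ := hflow φ
  set X : ℝ → Plane := fun t => (h₀ (f t) + t * (h₁ (f t) - h₀ (f t))) • unitDir (f t) +
    (deriv h₀ (f t) + t * g (f t)) • unitDir (f t + π / 2) with hX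
  have hderiv : ∀ t ∈ Icc (0 : ℝ) 1,
      HasDerivWithinAt X ((h₁ (f t) - h₀ (f t)) • unitDir (f t)) (Icc 0 1) t := fun t ht => by
    have d0 := (hs₀.hasDerivAt (f t)).comp_hasDerivWithinAt t (hf t ht)
    have d1 := (hs₁.hasDerivAt (f t)).comp_hasDerivWithinAt t (hf t ht)
    have dd0 := (hs₀.hasDerivAt_deriv (f t)).comp_hasDerivWithinAt t (hf t ht)
    have dd1 := (hs₁.hasDerivAt_deriv (f t)).comp_hasDerivWithinAt t (hf t ht)
    have du := (hasDerivAt_unitDir (f t)).scomp_hasDerivWithinAt t (hf t ht)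
    have dv := (hasDerivAt_unitDir_add_pi_div_two (f t)).scomp_hasDerivWithinAt t (hf t ht)
    have dt := hasDerivWithinAt_id t (Icc (0 : ℝ) 1)
    have key := ((d0.add (dt.mul (d1.sub d0))).smul du).add
      ((dd0.add (dt.mul (dd1.sub dd0))).smul dv)
    refine key.congr_deriv ?_
    have hRV : R t (f t) * V t (f t) = -g (f t) := by
      rw [hV, mul_neg, mul_div_cancel₀ _ (hm.trans_le (hRm t ht (f t))).ne']
    simp only [Function.comp_apply, id, Pi.add_apply, Pi.mul_apply, Pi.sub_apply]
    simp only [hR, hρ₀, hρ₁, hg] at hRV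
    generalize V t (f t) = v at hRV ⊢
    generalize unitDir (f t) = u
    generalize unitDir (f t + π / 2) = w
    linear_combination (norm := module) hRV • w
  have hnorm := norm_image_sub_le_of_norm_deriv_le_segment_01' hderiv (C := δ) fun t _ => by
    rw [norm_smul, norm_unitDir, mul_one]
    exact hδ _
  have hX0 : X 0 = supportCurve h₀ φ := by
    simp [hX, supportCurve, hf0]
  have hX1 : X 1 = supportCurve h₁ (F φ) := by
    simp [hX, supportCurve, hf1, hg]
  rwa [hX0, hX1, norm_sub_rev] at hnorm

end IsSmoothSupport

/-! ### Smoothing of support functions -/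

/-- The support function in polar coordinates of the range of `β`. -/
def supportFun (β : ℝ → Plane) (φ : ℝ) : ℝ := ⨆ t, ⟪β t, unitDir φ⟫

/-- The inequality satisfied by support functions in polar coordinates. -/
def IsTrigConvex (H : ℝ → ℝ) : Prop :=
  ∀ φ s, 0 ≤ Real.cos s → 2 * Real.cos s * H φ ≤ H (φ + s) + H (φ - s)

theorem unitDir_add_add_unitDir_sub (φ s : ℝ) :
    unitDir (φ + s) + unitDir (φ - s) = (2 * Real.cos s) • unitDir φ := by
  apply plane_ext
  · simp [unitDir, Real.cos_add, Real.cos_sub]; ring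
  · simp [unitDir, Real.sin_add, Real.sin_sub]; ring

theorem norm_unitDir_sub_le (φ ψ : ℝ) : ‖unitDir φ - unitDir ψ‖ ≤ |φ - ψ| := by
  have := Convex.norm_image_sub_le_of_norm_hasDerivWithin_le (s := univ) (C := 1)
    (fun z _ => (hasDerivAt_unitDir z).hasDerivWithinAt) (fun z _ => (norm_unitDir _).le)
    convex_univ (mem_univ ψ) (mem_univ φ)
  simpa using this

section SupportFun

variable {β : ℝ → Plane} {R : ℝ}

theorem inner_le_supportFun (hR : ∀ t, ‖β t‖ ≤ R) (t φ : ℝ) :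
    ⟪β t, unitDir φ⟫ ≤ supportFun β φ :=
  le_ciSup (f := fun t => ⟪β t, unitDir φ⟫) ⟨R, by
    rintro _ ⟨t, rfl⟩
    refine (real_inner_le_norm _ _).trans ?_
    rw [norm_unitDir, mul_one]
    exact hR t⟩ t

theorem abs_supportFun_sub_le (hR : ∀ t, ‖β t‖ ≤ R) (φ ψ : ℝ) :
    |supportFun β φ - supportFun β ψ| ≤ R * |φ - ψ| := by
  have key : ∀ φ ψ, supportFun β φ ≤ supportFun β ψ + R * |φ - ψ| := fun φ ψ => by
    refine ciSup_le fun t => ?_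
    have h1 := inner_le_supportFun hR t ψ
    have h2 : ⟪β t, unitDir φ - unitDir ψ⟫ ≤ R * |φ - ψ| :=
      (real_inner_le_norm _ _).trans (mul_le_mul (hR t) (norm_unitDir_sub_le φ ψ)
        (norm_nonneg _) ((norm_nonneg _).trans (hR t)))
    rw [inner_sub_right] at h2
    linarith
  rw [abs_sub_le_iff]
  have h1 := key φ ψ
  have h2 := key ψ φ
  rw [abs_sub_comm] at h2
  constructor <;> linarith

theorem supportFun_periodic (β : ℝ → Plane) : Function.Periodic (supportFun β) (2 * π) :=
  fun φ => by simp only [supportFun, unitDir_add_two_pi]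

/-- Sublinearity of the support function, applied to `unitDir (φ + s) + unitDir (φ - s) = 2 cos s •
unitDir φ`. -/
theorem isTrigConvex_supportFun (hR : ∀ t, ‖β t‖ ≤ R) : IsTrigConvex (supportFun β) := by
  intro φ s hs
  conv_lhs => rw [supportFun, Real.mul_iSup_of_nonneg (by positivity)]
  refine ciSup_le fun t => ?_
  rw [← inner_smul_right, ← unitDir_add_add_unitDir_sub, inner_add_right]
  exact add_le_add (inner_le_supportFun hR _ _) (inner_le_supportFun hR _ _)

theorem supportFun_sub_const (hR : ∀ t, ‖β t‖ ≤ R) (c : Plane) (φ : ℝ) :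
    supportFun (fun t => β t - c) φ = supportFun β φ - ⟪c, unitDir φ⟫ := by
  have hbdd : BddAbove (range fun t => ⟪β t, unitDir φ⟫) :=
    ⟨_, by rintro _ ⟨t, rfl⟩; exact inner_le_supportFun hR t φ⟩
  simp only [supportFun, inner_sub_left]
  rw [ciSup_sub hbdd]

end SupportFun

/-- The function `G` is nonnegative near `0`, vanishes at `0` and has `G''(0) = 2 (F φ + F'' φ)`. A
negative value would make `0` a local maximum, so `G` would vanish near `0`, and so would `G''(0)`.
-/
theorem IsTrigConvex.add_deriv_deriv_nonneg {F : ℝ → ℝ} (hF : ContDiff ℝ ∞ F)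
    (hc : IsTrigConvex F) (φ : ℝ) : 0 ≤ F φ + deriv (deriv F) φ := by
  have hd1 := (contDiff_infty_iff_deriv.1 hF).2
  have e1 : ∀ x, HasDerivAt F (deriv F x) x :=
    fun x => ((contDiff_infty_iff_deriv.1 hF).1 x).hasDerivAt
  have e2 : ∀ x, HasDerivAt (deriv F) (deriv (deriv F) x) x :=
    fun x => ((contDiff_infty_iff_deriv.1 hd1).1 x).hasDerivAt
  set G : ℝ → ℝ := fun s => F (φ + s) + F (φ - s) - 2 * Real.cos s * F φ with hG
  have g1 : deriv G = fun s => deriv F (φ + s) - deriv F (φ - s) + 2 * Real.sin s * F φ := by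
    funext s
    have := (((e1 (φ + s)).comp_const_add φ s).add ((e1 (φ - s)).comp_const_sub φ s)).sub
      (((Real.hasDerivAt_cos s).const_mul 2).mul_const (F φ))
    rw [HasDerivAt.deriv (f := G) this]
    ring
  have g2 : deriv (deriv G) 0 = 2 * (F φ + deriv (deriv F) φ) := by
    rw [g1]
    have := (((e2 (φ + 0)).comp_const_add φ 0).sub ((e2 (φ - 0)).comp_const_sub φ 0)).add
      (((Real.hasDerivAt_sin 0).const_mul 2).mul_const (F φ))
    rw [HasDerivAt.deriv (f := fun s => deriv F (φ + s) - deriv F (φ - s) +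
      2 * Real.sin s * F φ) this]
    simp
    ring
  by_contra! hneg
  have hG0 : G 0 = 0 := by simp [hG]; ring
  have hcont : ContinuousAt G 0 := by
    have := hF.continuous
    simp only [hG]
    fun_prop
  have hmax := isLocalMax_of_deriv_deriv_neg (f := G) (x₀ := 0) (by rw [g2]; linarith)
    (by rw [g1]; simp) hcont
  have hcos : ∀ᶠ s in 𝓝 (0 : ℝ), 0 < Real.cos s :=
    continuousAt_const.eventually_lt Real.continuous_cos.continuousAt (by simp)
  have hzero : G =ᶠ[𝓝 0] fun _ => (0 : ℝ) := by
    filter_upwards [hmax, hcos] with s hs hs'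
    rw [hG0] at hs
    exact le_antisymm hs (sub_nonneg.2 (hc φ s hs'.le))
  have := hzero.deriv.deriv_eq
  rw [g2] at this
  simp at this
  linarith

/-- Convolution with a nonnegative bump averages translates, and the trigonometric inequality is
linear and translation invariant. The Lipschitz bound controls the error. -/
theorem exists_smooth_trigConvex {H : ℝ → ℝ} {R : ℝ}
    (hl : ∀ x y, |H x - H y| ≤ R * |x - y|) (hp : Function.Periodic H (2 * π))
    (hc : IsTrigConvex H) {ε : ℝ} (hε : 0 < ε) :
    ∃ F : ℝ → ℝ, ContDiff ℝ ∞ F ∧ Function.Periodic F (2 * π) ∧ IsTrigConvex F ∧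
      ∀ x, |F x - H x| ≤ ε := by
  have hR : 0 ≤ R := by
    have := (abs_nonneg _).trans (hl 1 0)
    simpa using this
  have hcont : Continuous H := by
    refine (LipschitzWith.of_dist_le_mul (K := R.toNNReal) fun x y => ?_).continuous
    rw [Real.coe_toNNReal _ hR]
    exact hl x y
  set r := ε / (R + 1) with hr
  have hr0 : 0 < r := by positivity
  let b : ContDiffBump (0 : ℝ) := ⟨r / 2, r, by positivity, by linarith⟩
  set F : ℝ → ℝ := (b.normed volume ⋆[ContinuousLinearMap.lsmul ℝ ℝ, volume] H) with hF
  have hFx : ∀ x, F x = ∫ t, b.normed volume t * H (x - t) := fun x => by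
    simp [hF, convolution]
  have hint : ∀ f : ℝ → ℝ, Continuous f → Integrable fun t => b.normed volume t * f t :=
    fun f hf => (b.continuous_normed.mul hf).integrable_of_hasCompactSupport
      b.hasCompactSupport_normed.mul_right
  refine ⟨F, ?_, fun x => ?_, fun φ s hs => ?_, fun x => ?_⟩
  · exact b.hasCompactSupport_normed.contDiff_convolution_left _ b.contDiff_normed
      hcont.locallyIntegrable
  · rw [hFx, hFx]
    congr 1
    funext t
    rw [show x + 2 * π - t = x - t + 2 * π by ring, hp]
  · rw [hFx, hFx, hFx, ← integral_const_mul, ← integral_add (hint _ (by fun_prop))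
      (hint _ (by fun_prop))]
    refine integral_mono ((hint _ (by fun_prop)).const_mul _) ((hint _ (by fun_prop)).add
      (hint _ (by fun_prop))) fun t => ?_
    have h1 := mul_le_mul_of_nonneg_left (hc (φ - t) s hs) (b.nonneg_normed (μ := volume) t)
    rw [show φ - t + s = φ + s - t by ring, show φ - t - s = φ - s - t by ring] at h1
    linarith
  · rw [← Real.dist_eq]
    refine b.dist_normed_convolution_le hcont.aestronglyMeasurable fun y hy => ?_
    rw [Real.dist_eq]
    refine (hl y x).trans ?_
    have hy' : |y - x| ≤ r := (mem_ball_iff_norm.1 hy).le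
    calc R * |y - x| ≤ (R + 1) * r := by gcongr; linarith
      _ = ε := by rw [hr]; field_simp

/-- Smoothing to within `ε / 2` and then adding `ε / 2` makes the radius of curvature strictly
positive and puts the approximation above the original. -/
theorem exists_isSmoothSupport {β : ℝ → Plane} {R : ℝ} (hR : ∀ t, ‖β t‖ ≤ R) {ε : ℝ}
    (hε : 0 < ε) : ∃ h, IsSmoothSupport h ∧ ∀ φ, supportFun β φ ≤ h φ ∧
      h φ ≤ supportFun β φ + ε := by
  obtain ⟨F, hF, hp, hc, hd⟩ := exists_smooth_trigConvex (abs_supportFun_sub_le hR)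
    (supportFun_periodic β) (isTrigConvex_supportFun hR) (half_pos hε)
  have hder : deriv (fun φ => F φ + ε / 2) = deriv F := funext fun x => deriv_add_const _
  refine ⟨fun φ => F φ + ε / 2, ⟨hF.add contDiff_const, fun x => by simp only [hp x], fun φ => ?_⟩,
    fun φ => ?_⟩
  · rw [hder]
    have := hc.add_deriv_deriv_nonneg hF φ
    linarith
  · have := abs_le.1 (hd φ)
    constructor <;> linarith

/-! ### Properties of smooth support functions -/

namespace IsSmoothSupport

variable {h : ℝ → ℝ}

/-- The effect of a translation by `c`; it lets the smoothing be done with the interior point at the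
origin. -/
theorem add_inner (hs : IsSmoothSupport h) (c : Plane) :
    IsSmoothSupport (fun φ => h φ + ⟪c, unitDir φ⟫) ∧
      ∀ φ, supportCurve (fun φ => h φ + ⟪c, unitDir φ⟫) φ = supportCurve h φ + c := by
  have e : ∀ φ, HasDerivAt (fun φ => ⟪c, unitDir φ⟫) ⟪c, unitDir (φ + π / 2)⟫ φ := fun φ => by
    simpa using (hasDerivAt_const φ c).inner ℝ (hasDerivAt_unitDir φ)
  have e' : ∀ φ, HasDerivAt (fun φ => ⟪c, unitDir (φ + π / 2)⟫) (-⟪c, unitDir φ⟫) φ := fun φ => by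
    simpa using (hasDerivAt_const φ c).inner ℝ (hasDerivAt_unitDir_add_pi_div_two φ)
  have d1 : deriv (fun φ => h φ + ⟪c, unitDir φ⟫) =
      fun φ => deriv h φ + ⟪c, unitDir (φ + π / 2)⟫ :=
    funext fun φ => ((hs.hasDerivAt φ).add (e φ)).deriv
  have d2 : deriv (fun φ => deriv h φ + ⟪c, unitDir (φ + π / 2)⟫) =
      fun φ => deriv (deriv h) φ + -⟪c, unitDir φ⟫ :=
    funext fun φ => ((hs.hasDerivAt_deriv φ).add (e' φ)).deriv
  refine ⟨⟨hs.contDiff.add ?_, fun φ => ?_, fun φ => ?_⟩, fun φ => ?_⟩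
  · simp only [plane_inner, unitDir_apply_zero, unitDir_apply_one]
    exact (contDiff_const.mul Real.contDiff_cos).add (contDiff_const.mul Real.contDiff_sin)
  · simp only [hs.periodic φ, unitDir_add_two_pi]
  · rw [d1, d2]
    have := hs.curvature_pos φ
    linarith
  · rw [supportCurve, supportCurve, d1]
    have hc : c = ⟪c, unitDir φ⟫ • unitDir φ + ⟪c, unitDir (φ + π / 2)⟫ • unitDir (φ + π / 2) := by
      apply plane_ext
      · simp [plane_inner, unitDir, Real.cos_add_pi_div_two, Real.sin_add_pi_div_two]
        linear_combination (-(c 0)) * Real.cos_sq_add_sin_sq φ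
      · simp [plane_inner, unitDir, Real.cos_add_pi_div_two, Real.sin_add_pi_div_two]
        linear_combination (-(c 1)) * Real.cos_sq_add_sin_sq φ
    conv_rhs => rw [hc]
    module

theorem inner_supportCurve (h : ℝ → ℝ) (φ ψ : ℝ) :
    ⟪supportCurve h φ, unitDir ψ⟫ = h φ * Real.cos (ψ - φ) + deriv h φ * Real.sin (ψ - φ) := by
  rw [supportCurve, inner_add_left, inner_smul_left, inner_smul_left, inner_unitDir,
    inner_unitDir, ← Real.cos_neg (φ - ψ), neg_sub, ← Real.cos_pi_div_two_sub (ψ - φ),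
    show φ + π / 2 - ψ = π / 2 - (ψ - φ) by ring]
  simp

theorem hasDerivAt_inner_supportCurve (hs : IsSmoothSupport h) (φ ψ : ℝ) :
    HasDerivAt (fun φ => ⟪supportCurve h φ, unitDir ψ⟫)
      ((h φ + deriv (deriv h) φ) * Real.sin (ψ - φ)) φ := by
  simp only [inner_supportCurve]
  have d : HasDerivAt (fun φ => ψ - φ) (-1) φ := by
    simpa using (hasDerivAt_id φ).const_sub ψ
  refine (((hs.hasDerivAt φ).mul d.cos).add ((hs.hasDerivAt_deriv φ).mul d.sin)).congr_deriv ?_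
  ring

theorem inner_supportCurve_self (h : ℝ → ℝ) (φ : ℝ) :
    ⟪supportCurve h φ, unitDir φ⟫ = h φ := by
  simp [inner_supportCurve]

/-- As a function of `φ` the left side has derivative radius of curvature times `sin (ψ - φ)`. So
for `|φ - ψ| ≤ π` it is largest at `φ = ψ`, where it equals `h ψ`; shifting `ψ` by a multiple of
`2π` covers the rest. -/
theorem inner_supportCurve_le (hs : IsSmoothSupport h) (φ ψ : ℝ) :
    ⟪supportCurve h φ, unitDir ψ⟫ ≤ h ψ := by
  have key : ∀ ψ, |φ - ψ| ≤ π → ⟪supportCurve h φ, unitDir ψ⟫ ≤ h ψ := by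
    intro ψ hψ
    have hcont : Continuous fun φ => ⟪supportCurve h φ, unitDir ψ⟫ :=
      continuous_iff_continuousAt.2 fun φ => (hs.hasDerivAt_inner_supportCurve φ ψ).continuousAt
    rw [abs_le] at hψ
    rw [← inner_supportCurve_self h ψ]
    rcases le_total φ ψ with hle | hle
    · refine monotoneOn_of_deriv_nonneg (convex_Icc φ ψ) hcont.continuousOn
        (fun x _ => (hs.hasDerivAt_inner_supportCurve x ψ).differentiableAt.differentiableWithinAt)
        (fun x hx => ?_) (left_mem_Icc.2 hle) (right_mem_Icc.2 hle) hle
      rw [interior_Icc] at hx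
      rw [(hs.hasDerivAt_inner_supportCurve x ψ).deriv]
      exact mul_nonneg (hs.curvature_pos x).le
        (Real.sin_nonneg_of_nonneg_of_le_pi (by linarith [hx.2]) (by linarith [hx.1, hψ.1]))
    · refine antitoneOn_of_deriv_nonpos (convex_Icc ψ φ) hcont.continuousOn
        (fun x _ => (hs.hasDerivAt_inner_supportCurve x ψ).differentiableAt.differentiableWithinAt)
        (fun x hx => ?_) (left_mem_Icc.2 hle) (right_mem_Icc.2 hle) hle
      rw [interior_Icc] at hx
      rw [(hs.hasDerivAt_inner_supportCurve x ψ).deriv]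
      exact mul_nonpos_of_nonneg_of_nonpos (hs.curvature_pos x).le
        (Real.sin_nonpos_of_nonpos_of_neg_pi_le (by linarith [hx.1]) (by linarith [hx.2, hψ.2]))
  set k := round ((φ - ψ) / (2 * π)) with hk
  have hu : unitDir (ψ + k * (2 * π)) = unitDir ψ :=
    (show Function.Periodic unitDir (2 * π) from unitDir_add_two_pi).int_mul k ψ
  have := key (ψ + k * (2 * π)) (by
    have h1 := abs_sub_round ((φ - ψ) / (2 * π))
    rw [← hk] at h1
    have h2 : φ - (ψ + k * (2 * π)) = (2 * π) * ((φ - ψ) / (2 * π) - k) := by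
      field_simp
      ring
    rw [h2, abs_mul, abs_of_pos (by positivity)]
    nlinarith [Real.pi_pos])
  rwa [hu, hs.periodic.int_mul k ψ] at this

/-- The polar angle of the point with outer normal `unitDir φ`. -/
def _root_.supportAngle (h : ℝ → ℝ) (φ : ℝ) : ℝ := φ + Real.arctan (deriv h φ / h φ)

theorem supportCurve_eq_smul (φ : ℝ) (hpos : 0 < h φ) :
    ∃ l : ℝ, 0 < l ∧ supportCurve h φ = l • unitDir (supportAngle h φ) := by
  set x := deriv h φ / h φ with hx
  have hq : 0 < √(1 + x ^ 2) := Real.sqrt_pos.2 (by positivity)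
  have hd : deriv h φ = h φ * x := by rw [hx]; field_simp
  refine ⟨h φ * √(1 + x ^ 2), by positivity, ?_⟩
  rw [supportCurve, supportAngle, ← hx, hd]
  apply plane_ext
  · simp [unitDir, Real.cos_add, Real.cos_arctan, Real.sin_arctan]
    field_simp
    ring
  · simp [unitDir, Real.sin_add, Real.cos_arctan, Real.sin_arctan]
    field_simp

theorem hasDerivAt_supportAngle (hs : IsSmoothSupport h) (hpos : ∀ φ, 0 < h φ) (φ : ℝ) :
    HasDerivAt (supportAngle h)
      (h φ * (h φ + deriv (deriv h) φ) / (h φ ^ 2 + deriv h φ ^ 2)) φ := by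
  have hp := hpos φ
  have hq : 0 < h φ ^ 2 + deriv h φ ^ 2 := by positivity
  refine ((hasDerivAt_id φ).add (((hs.hasDerivAt_deriv φ).div (hs.hasDerivAt φ)
    hp.ne').arctan)).congr_deriv ?_
  have : 0 < 1 + (deriv h φ / h φ) ^ 2 := by positivity
  rw [Pi.div_apply]
  field_simp
  ring

theorem strictMono_supportAngle (hs : IsSmoothSupport h) (hpos : ∀ φ, 0 < h φ) :
    StrictMono (supportAngle h) := by
  refine strictMono_of_deriv_pos fun φ => ?_
  rw [(hs.hasDerivAt_supportAngle hpos φ).deriv]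
  have := hs.curvature_pos φ
  have := hpos φ
  positivity

theorem continuous_supportAngle (hs : IsSmoothSupport h) (hpos : ∀ φ, 0 < h φ) :
    Continuous (supportAngle h) :=
  continuous_iff_continuousAt.2 fun φ => (hs.hasDerivAt_supportAngle hpos φ).continuousAt

theorem supportAngle_add_two_pi (hs : IsSmoothSupport h) (φ : ℝ) :
    supportAngle h (φ + 2 * π) = supportAngle h φ + 2 * π := by
  rw [supportAngle, supportAngle, hs.periodic φ, hs.periodic.deriv_periodic φ]
  ring

end IsSmoothSupport

/-! ### Approximation of convex curves by smooth ones -/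

theorem exists_eq_norm_smul_unitDir (w : Plane) : ∃ φ, w = ‖w‖ • unitDir φ := by
  set z : ℂ := ⟨w 0, w 1⟩ with hz
  have hn : ‖w‖ = ‖z‖ := by
    rw [← sq_eq_sq₀ (norm_nonneg _) (norm_nonneg _), ← real_inner_self_eq_norm_sq, plane_inner,
      Complex.sq_norm, Complex.normSq_apply]
  refine ⟨z.arg, plane_ext ?_ ?_⟩
  · simp [unitDir, hn, Complex.norm_mul_cos_arg, hz]
  · simp [unitDir, hn, Complex.norm_mul_sin_arg, hz]

theorem surjective_of_abs_sub_le {f : ℝ → ℝ} (hf : Continuous f) {a C : ℝ} (ha : 0 < a)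
    (h : ∀ x, |f x - a * x| ≤ C) : Function.Surjective f := by
  refine hf.surjective ?_ ?_
  · refine tendsto_atTop_mono (f := fun x => a * x + -C) (fun x => ?_)
      (tendsto_atTop_add_const_right _ _ (tendsto_id.const_mul_atTop ha))
    have := (abs_le.1 (h x)).1
    linarith
  · refine tendsto_atBot_mono (f := fun x => a * x + C) (fun x => ?_)
      (tendsto_atBot_add_const_right _ _ (tendsto_id.const_mul_atBot ha))
    have := (abs_le.1 (h x)).2
    linarith

/-- Hahn–Banach: a line separating `z` from `K` has a normal direction in which the support bound
fails. -/
theorem mem_of_forall_inner_le {K : Set Plane} (hK : Convex ℝ K) (hc : IsClosed K)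
    {β : ℝ → Plane} {c : Plane} (hβ : ∀ t, β t ∈ K) {z : Plane}
    (h : ∀ φ, ⟪z - c, unitDir φ⟫ ≤ supportFun (fun t => β t - c) φ) : z ∈ K := by
  by_contra hz
  obtain ⟨f, s, hf, hs⟩ := geometric_hahn_banach_closed_point hK hc hz
  set w : Plane := (InnerProductSpace.toDual ℝ Plane).symm f with hw
  have hfw : ∀ x, f x = ⟪x, w⟫ := fun x => by
    rw [real_inner_comm, hw, InnerProductSpace.toDual_symm_apply]
  obtain ⟨φ, hφ⟩ := exists_eq_norm_smul_unitDir w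
  have h1 : ‖w‖ * supportFun (fun t => β t - c) φ ≤ s - f c := by
    rw [supportFun, Real.mul_iSup_of_nonneg (norm_nonneg _)]
    refine ciSup_le fun t => ?_
    rw [← inner_smul_right, ← hφ, inner_sub_left, ← hfw, ← hfw]
    linarith [hf _ (hβ t)]
  have h2 := mul_le_mul_of_nonneg_left (h φ) (norm_nonneg w)
  rw [← inner_smul_right, ← hφ, inner_sub_left, ← hfw, ← hfw] at h2
  linarith

namespace IsPolarAngle

variable {γ : ℝ → Plane} {c : Plane} {θ : ℝ → ℝ}

theorem surjective (h : IsPolarAngle γ c θ) : Function.Surjective θ := by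
  have hp : Function.Periodic (fun t => θ t - 2 * π * t) 1 := fun t => by
    simp only [h.add_one]; ring
  have hcont : Continuous fun t => θ t - 2 * π * t :=
    h.continuous.sub (continuous_const.mul continuous_id)
  obtain ⟨C, hC⟩ := (hp.isBounded_of_continuous one_ne_zero hcont).exists_norm_le
  exact surjective_of_abs_sub_le h.continuous (a := 2 * π) (by positivity)
    fun x => hC _ (mem_range_self x)

theorem exists_pos_le_supportFun (h : IsPolarAngle γ c θ) :
    ∃ r, 0 < r ∧ ∀ φ, r ≤ supportFun (fun t => γ t - c) φ := by
  obtain ⟨R, hR⟩ := h.closed.isCompact_range.isBounded.exists_norm_le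
  have hR' : ∀ t, ‖γ t - c‖ ≤ R + ‖c‖ := fun t =>
    (norm_sub_le _ _).trans (by linarith [hR _ (mem_range_self t)])
  obtain ⟨r, hr, hball⟩ := Metric.isOpen_iff.1 isOpen_interior c h.mem_interior
  refine ⟨r / 2, half_pos hr, fun φ => ?_⟩
  have hsub : convexHull ℝ (range γ) ⊆
      {x | ⟪unitDir φ, x⟫ ≤ supportFun (fun t => γ t - c) φ + ⟪unitDir φ, c⟫} := by
    refine convexHull_min ?_ (convex_halfSpace_le (innerₛₗ ℝ (unitDir φ)).isLinear _)
    rintro _ ⟨t, rfl⟩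
    have := inner_le_supportFun hR' t φ
    rw [real_inner_comm, inner_sub_right] at this
    rw [mem_ofPred_eq]
    linarith
  have hmem : c + (r / 2) • unitDir φ ∈ convexHull ℝ (range γ) := interior_subset <| hball <| by
    rw [mem_ball_iff_norm, add_sub_cancel_left, norm_smul, norm_unitDir, Real.norm_eq_abs,
      abs_of_pos (by positivity)]
    linarith
  have := hsub hmem
  rw [mem_ofPred_eq, inner_add_right, inner_smul_right, inner_unitDir, sub_self, Real.cos_zero]
    at this
  linarith

/-- Every convex curve is close to a smooth one with nearly the same support function. -/
theorem exists_isSmoothSupport (h : IsPolarAngle γ c θ) {ε : ℝ} (hε : 0 < ε) :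
    ∃ (f : ℝ → ℝ) (τ : ℝ ≃o ℝ), IsSmoothSupport f ∧ (∀ φ, |f φ - supportFun γ φ| ≤ ε) ∧
      (∀ t, τ (t + 1) = τ t + 2 * π) ∧ ∀ t, ‖γ t - supportCurve f (τ t)‖ ≤ ε := by
  obtain ⟨R₀, hR₀⟩ := h.closed.isCompact_range.isBounded.exists_norm_le
  have hγR : ∀ t, ‖γ t‖ ≤ R₀ := fun t => hR₀ _ (mem_range_self t)
  set R := R₀ + ‖c‖ with hR
  have hβR : ∀ t, ‖γ t - c‖ ≤ R := fun t => (norm_sub_le _ _).trans (by linarith [hγR t])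
  have hR0 : 0 ≤ R := (norm_nonneg _).trans (hβR 0)
  obtain ⟨r, hr, hrH⟩ := h.exists_pos_le_supportFun
  -- The first bound serves the support functions. The second serves the points: radii about `c` are
  -- at most `R` and change by a relative error at most `ε₁ / r`.
  set ε₁ := min ε (ε * r / (R + 1)) with hε₁
  have hε₁0 : 0 < ε₁ := lt_min hε (by positivity)
  obtain ⟨g, hg, hgH⟩ := _root_.exists_isSmoothSupport hβR hε₁0
  have hgpos : ∀ φ, 0 < g φ := fun φ => hr.trans_le ((hrH φ).trans (hgH φ).1)
  obtain ⟨hf, hfcurve⟩ := hg.add_inner c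
  set f : ℝ → ℝ := fun φ => g φ + ⟪c, unitDir φ⟫ with hfdef
  have hsurjA : Function.Surjective (supportAngle g) := by
    refine surjective_of_abs_sub_le (hg.continuous_supportAngle hgpos) one_pos (C := π / 2)
      fun x => ?_
    rw [supportAngle, one_mul, add_sub_cancel_left]
    exact abs_le.2 ⟨(Real.neg_pi_div_two_lt_arctan _).le, (Real.arctan_lt_pi_div_two _).le⟩
  set A := (hg.strictMono_supportAngle hgpos).orderIsoOfSurjective _ hsurjA with hA
  set Θ := h.strictMono.orderIsoOfSurjective _ h.surjective with hΘ
  have hAapp : ∀ φ, A φ = supportAngle g φ := fun φ => rfl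
  have hΘapp : ∀ t, Θ t = θ t := fun t => rfl
  -- Points are matched by equal polar angle about `c`, so only their distances `N` and `l` from `c`
  -- must be compared.
  refine ⟨f, Θ.trans A.symm, hf, fun φ => ?_, fun t => ?_, fun t => ?_⟩
  · have h1 := hgH φ
    rw [supportFun_sub_const hγR] at h1
    have h2 : ε₁ ≤ ε := min_le_left _ _
    simp only [hfdef]
    rw [abs_le]
    constructor <;> linarith
  · simp only [OrderIso.trans_apply]
    rw [OrderIso.symm_apply_eq, hAapp, hg.supportAngle_add_two_pi, ← hAapp,
      OrderIso.apply_symm_apply, hΘapp, hΘapp, h.add_one]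
  · set φ := Θ.trans A.symm t with hφ
    have hangle : supportAngle g φ = θ t := by
      rw [← hAapp, hφ, OrderIso.trans_apply, OrderIso.apply_symm_apply, hΘapp]
    obtain ⟨l, hl, hcurve⟩ := IsSmoothSupport.supportCurve_eq_smul φ (hgpos φ)
    rw [hangle] at hcurve
    set e := unitDir (θ t) with he
    set N := ‖γ t - c‖ with hN
    have hpol : γ t - c = N • e := h.polar t
    have hself := IsSmoothSupport.inner_supportCurve_self g φ
    rw [hcurve, inner_smul_left] at hself
    simp only [conj_trivial] at hself
    have hepos : 0 < ⟪e, unitDir φ⟫ := by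
      have := hgpos φ
      rw [← hself] at this
      exact pos_of_mul_pos_right this hl.le
    -- The support line of the smooth curve at `φ` also bounds `γ`, because `g` dominates its
    -- support function.
    have hNl : N ≤ l := by
      have h1 := (inner_le_supportFun hβR t φ).trans (hgH φ).1
      rw [hpol, inner_smul_left, ← hself] at h1
      exact le_of_mul_le_mul_right h1 hepos
    have hη : 0 < 1 + ε₁ / r := by positivity
    -- Since the support function is at least `r`, adding `ε₁` multiplies it by at most `1 + ε₁ /
    -- r`; shrinking by this factor returns the smooth curve to the hull.
    have hz : c + (1 + ε₁ / r)⁻¹ • supportCurve g φ ∈ convexHull ℝ (range γ) := by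
      refine mem_of_forall_inner_le h.isConvexBody.convex h.isConvexBody.isCompact.isClosed
        h.mem_hull (c := c) fun ψ => ?_
      rw [add_sub_cancel_left, inner_smul_left, conj_trivial, inv_mul_le_iff₀ hη]
      refine (hg.inner_supportCurve_le φ ψ).trans ((hgH ψ).2.trans ?_)
      have h1 : ε₁ ≤ ε₁ / r * supportFun (fun t => γ t - c) ψ := by
        calc ε₁ = ε₁ / r * r := by field_simp
          _ ≤ _ := by gcongr; exact hrH ψ
      linarith
    have hlN : l / (1 + ε₁ / r) ≤ N := by
      refine le_of_smul_eq_smul_of_mem_frontier h.isConvexBody.convex h.mem_interior hz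
        (h.mem_frontier t) (norm_nonneg _) (e := e) ?_ hpol
      rw [add_sub_cancel_left, hcurve, smul_smul, div_eq_inv_mul l]
    rw [div_le_iff₀ hη] at hlN
    have hdiff : γ t - supportCurve f φ = (N - l) • e := by
      rw [hfcurve, hcurve, sub_smul, ← hpol]
      abel
    rw [hdiff, norm_smul, norm_unitDir, mul_one, Real.norm_eq_abs, abs_sub_comm,
      abs_of_nonneg (by linarith)]
    calc l - N ≤ N * (ε₁ / r) := by linarith
      _ ≤ (R + 1) * (ε * r / (R + 1) / r) := by
          gcongr
          · linarith [hβR t]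
          · exact min_le_right _ _
      _ = ε := by field_simp

end IsPolarAngle

/-! ### Equality of the Fréchet and Hausdorff distances -/

theorem supportFun_le_add_hausdorffDistance {γ γ' : ℝ → Plane} (h : IsClosedCurve γ)
    (h' : IsClosedCurve γ') (φ : ℝ) :
    supportFun γ φ ≤ supportFun γ' φ + hausdorffDistance γ γ' := by
  obtain ⟨R, hR⟩ := h'.isCompact_range.isBounded.exists_norm_le
  have hfin : Metric.hausdorffEDist (range γ) (range γ') ≠ ⊤ :=
    Metric.hausdorffEDist_ne_top_of_nonempty_of_bounded (range_nonempty γ) (range_nonempty γ')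
      h.isCompact_range.isBounded h'.isCompact_range.isBounded
  refine ciSup_le fun t => ?_
  obtain ⟨_, ⟨s, rfl⟩, hs⟩ := h'.isCompact_range.exists_infDist_eq_dist (range_nonempty γ') (γ t)
  have h1 := Metric.infDist_le_hausdorffDist_of_mem (mem_range_self t) hfin
  rw [hs, dist_eq_norm] at h1
  have h2 := real_inner_le_norm (γ t - γ' s) (unitDir φ)
  rw [norm_unitDir, mul_one, inner_sub_left] at h2
  have h3 := inner_le_supportFun (fun t => hR _ (mem_range_self t)) s φ
  rw [hausdorffDistance]
  linarith

theorem abs_supportFun_sub_le_hausdorffDistance {γ γ' : ℝ → Plane} (h : IsClosedCurve γ)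
    (h' : IsClosedCurve γ') (φ : ℝ) :
    |supportFun γ' φ - supportFun γ φ| ≤ hausdorffDistance γ γ' := by
  have h1 := supportFun_le_add_hausdorffDistance h h' φ
  have h2 := supportFun_le_add_hausdorffDistance h' h φ
  rw [hausdorffDistance, Metric.hausdorffDist_comm, ← hausdorffDistance] at h2
  rw [abs_le]
  constructor <;> linarith

theorem IsPolarAngle.exists_orderIso_dist_le {γ γ' : ℝ → Plane} {c c' : Plane} {θ θ' : ℝ → ℝ}
    (h : IsPolarAngle γ c θ) (h' : IsPolarAngle γ' c' θ') {ε : ℝ} (hε : 0 < ε) :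
    ∃ f : ℝ ≃o ℝ, (∀ t, f (t + 1) = f t + 1) ∧
      ∀ t, ‖γ t - γ' (f t)‖ ≤ hausdorffDistance γ γ' + ε := by
  obtain ⟨g, τ, hg, hgs, hτ, hgd⟩ := h.exists_isSmoothSupport (ε := ε / 4) (by positivity)
  obtain ⟨g', τ', hg', hgs', hτ', hgd'⟩ := h'.exists_isSmoothSupport (ε := ε / 4) (by positivity)
  obtain ⟨F, hF, hFd⟩ := hg.exists_orderIso_dist_le hg' (δ := hausdorffDistance γ γ' + ε / 2)
    fun φ => by
      have h1 := abs_le.1 (hgs φ)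
      have h2 := abs_le.1 (hgs' φ)
      have h3 := abs_le.1 (abs_supportFun_sub_le_hausdorffDistance h.closed h'.closed φ)
      rw [abs_le]
      constructor <;> linarith [h1.1, h1.2, h2.1, h2.2, h3.1, h3.2]
  refine ⟨(τ.trans F).trans τ'.symm, fun t => ?_, fun t => ?_⟩
  · simp only [OrderIso.trans_apply]
    rw [OrderIso.symm_apply_eq, hτ', OrderIso.apply_symm_apply, hτ, hF]
  · have e1 := hgd t
    have e2 := hFd (τ t)
    have e3 := hgd' ((τ.trans F).trans τ'.symm t)
    simp only [OrderIso.trans_apply, OrderIso.apply_symm_apply] at e3 ⊢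
    rw [norm_sub_rev] at e3
    have e4 := norm_sub_le_norm_sub_add_norm_sub (γ t) (supportCurve g (τ t))
      (γ' (τ'.symm (F (τ t))))
    have e5 := norm_sub_le_norm_sub_add_norm_sub (supportCurve g (τ t))
      (supportCurve g' (F (τ t))) (γ' (τ'.symm (F (τ t))))
    linarith

/-- For convex curves of the same orientation the Fréchet distance is the Hausdorff distance. -/
theorem frechetDistance_eq_hausdorffDistance {γ γ' : ℝ → Plane} (h : SameOrientation γ γ')
    (hc : IsClosedCurve γ) (hc' : IsClosedCurve γ') (hv : IsConvexCurve γ)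
    (hv' : IsConvexCurve γ') : frechetDistance γ γ' = hausdorffDistance γ γ' := by
  refine le_antisymm (le_of_forall_pos_le_add fun ε hε => ?_)
    (hausdorffDistance_le_frechetDistance hc hc')
  rcases h with ⟨h1, h2⟩ | ⟨h1, h2⟩
  · obtain ⟨c, θ, h⟩ := h1.exists_isPolarAngle hc hv
    obtain ⟨c', θ', h'⟩ := h2.exists_isPolarAngle hc' hv'
    obtain ⟨f, hf, hd⟩ := h.exists_orderIso_dist_le h' hε
    exact frechetDistance_le_of_orderIso f hf hd
  · obtain ⟨c, θ, h⟩ := h1.comp_neg.exists_isPolarAngle hc.comp_neg hv.comp_neg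
    obtain ⟨c', θ', h'⟩ := h2.comp_neg.exists_isPolarAngle hc'.comp_neg hv'.comp_neg
    obtain ⟨f, hf, hd⟩ := h.exists_orderIso_dist_le h' hε
    rw [hausdorffDistance, range_comp_neg, range_comp_neg, ← hausdorffDistance] at hd
    -- Conjugation by `t ↦ -t` turns a matching of the reversed curves into one of the original
    -- curves.
    let g : ℝ ≃o ℝ := ((OrderIso.neg ℝ).trans f.dual).trans (OrderIso.neg ℝ).symm
    have hg : ∀ t, g t = -f (-t) := fun t => rfl
    refine frechetDistance_le_of_orderIso g (fun t => ?_) fun t => ?_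
    · have := hf (-(t + 1))
      rw [show -(t + 1) + 1 = -t by ring] at this
      rw [hg, hg, this]
      ring
    · simpa [hg] using hd (-t)

/-! ### Uniform error bound and the main theorem -/

theorem one_sub_exp_neg_sq_div_le {R ε σ d : ℝ} (hε : 0 < ε) (hR : 0 ≤ R)
    (hσ : (R + 1) / √ε ≤ σ) (hd0 : 0 ≤ d) (hd : d ≤ R) :
    1 - Real.exp (-(d ^ 2 / σ ^ 2)) ≤ ε := by
  have hσ0 : 0 < σ := lt_of_lt_of_le (by positivity) hσ
  rw [div_le_iff₀ (Real.sqrt_pos.2 hε)] at hσ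
  have h1 : d ^ 2 ≤ ε * σ ^ 2 := by
    calc d ^ 2 ≤ (σ * √ε) ^ 2 := by gcongr; linarith
      _ = ε * σ ^ 2 := by rw [mul_pow, Real.sq_sqrt hε.le, mul_comm]
  have h2 : d ^ 2 / σ ^ 2 ≤ ε := (div_le_iff₀ (by positivity)).2 h1
  have h3 := Real.add_one_le_exp (-(d ^ 2 / σ ^ 2))
  linarith

end

theorem mainTheorem5 (Ω : Set Plane) (hΩ_open : IsOpen Ω) (hΩ_conn : IsConnected Ω)
    (hΩ_bdd : Bornology.IsBounded Ω) :
    (∀ (σ : ℝ) (γ γ' : ℝ → Plane), 0 < σ → IsConvexPair Ω γ γ' →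
      hausdorffDistance γ γ' ≤ σ / Real.sqrt (2 * Real.exp 1) →
        largeScaleOrientationDist (uniformDensity Ω) σ γ γ' = 1 / σ * frechetDistance γ γ' ∧
        Real.exp (-(hausdorffDistance γ γ' ^ 2 / σ ^ 2)) * (1 / σ * frechetDistance γ γ') ≤
          orientationDist (uniformDensity Ω) σ γ γ' ∧
        orientationDist (uniformDensity Ω) σ γ γ' ≤ 1 / σ * frechetDistance γ γ') ∧
    (∀ ε : ℝ, 0 < ε → ∃ σ₀ : ℝ, 0 < σ₀ ∧ ∀ (σ : ℝ) (γ γ' : ℝ → Plane), σ₀ ≤ σ →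
      IsConvexPair Ω γ γ' → hausdorffDistance γ γ' ≤ σ / Real.sqrt (2 * Real.exp 1) →
        |orientationDist (uniformDensity Ω) σ γ γ' - 1 / σ * frechetDistance γ γ'| ≤
          ε * (1 / σ * frechetDistance γ γ')) := by
  have hμ : ∀ {β : ℝ → Plane}, range β ⊆ Ω → ∀ t, 0 < uniformDensity Ω (β t) := fun hβ t =>
    (uniformDensity_pos_iff hΩ_open hΩ_conn.nonempty hΩ_bdd _).2 (hβ (mem_range_self t))
  have main : ∀ (σ : ℝ) (γ γ' : ℝ → Plane), 0 < σ → IsConvexPair Ω γ γ' →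
      largeScaleOrientationDist (uniformDensity Ω) σ γ γ' = 1 / σ * frechetDistance γ γ' ∧
      Real.exp (-(hausdorffDistance γ γ' ^ 2 / σ ^ 2)) * (1 / σ * frechetDistance γ γ') ≤
        orientationDist (uniformDensity Ω) σ γ γ' ∧
      orientationDist (uniformDensity Ω) σ γ γ' ≤ 1 / σ * frechetDistance γ γ' := by
    intro σ γ γ' hσ hp
    obtain ⟨e, h, h'⟩ := hp.orientation.exists_isOrientedBoundary hp.closed_left hp.closed_right
      hp.convex_left hp.convex_right
    rw [frechetDistance_eq_hausdorffDistance hp.orientation hp.closed_left hp.closed_right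
      hp.convex_left hp.convex_right]
    exact ⟨largeScaleOrientationDist_eq h h' (hμ hp.subset_left) (hμ hp.subset_right) hσ,
      le_orientationDist h h' (hμ hp.subset_left) (hμ hp.subset_right) hσ,
      orientationDist_le h h' hσ⟩
  refine ⟨fun σ γ γ' hσ hp _ => main σ γ γ' hσ hp, fun ε hε => ?_⟩
  -- The relative error is at most `1 - exp(-d_H² / σ²) ≤ (diam Ω)² / σ²`, which is at most `ε`
  -- here; the `+ 1` keeps the threshold positive.
  refine ⟨(Metric.diam Ω + 1) / √ε, div_pos (by positivity) (Real.sqrt_pos.2 hε),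
    fun σ γ γ' hσ hp _ => ?_⟩
  have hσ0 : 0 < σ :=
    lt_of_lt_of_le (div_pos (by positivity) (Real.sqrt_pos.2 hε)) hσ
  obtain ⟨-, hlow, hup⟩ := main σ γ γ' hσ0 hp
  have hd : hausdorffDistance γ γ' ≤ Metric.diam Ω := by
    refine Metric.hausdorffDist_le_of_mem_dist Metric.diam_nonneg ?_ ?_
    · intro x hx
      exact ⟨γ' 0, mem_range_self 0, Metric.dist_le_diam_of_mem hΩ_bdd (hp.subset_left hx)
        (hp.subset_right (mem_range_self 0))⟩
    · intro x hx
      exact ⟨γ 0, mem_range_self 0, Metric.dist_le_diam_of_mem hΩ_bdd (hp.subset_right hx)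
        (hp.subset_left (mem_range_self 0))⟩
  have hexp := one_sub_exp_neg_sq_div_le hε Metric.diam_nonneg hσ (hausdorffDistance_nonneg γ γ') hd
  have hF : 0 ≤ 1 / σ * frechetDistance γ γ' := by
    refine mul_nonneg (one_div_pos.2 hσ0).le ?_
    exact (hausdorffDistance_nonneg γ γ').trans
      (hausdorffDistance_le_frechetDistance hp.closed_left hp.closed_right)
  rw [abs_sub_comm, abs_of_nonneg (sub_nonneg.2 hup)]
  have := mul_le_mul_of_nonneg_right hexp hF
  linarith
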